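/- Let $N,K,P$ be the numbers of observations, predictors and outcomes. Let $\mathbf Y\in\mathbb R^{N\times P}$ and $\mathbf X\in\mathbb R^{N\times K}$ have rows $\mathbf y_i'$ and $\mathbf x_i'$, and consider the multivariate normal linear model in which the $\mathbf y_i$ are independent, $\mathbf y_i\sim N(\boldsymbol\Theta'\mathbf x_i,\boldsymbol\Sigma)$, with $\boldsymbol\Theta\in\mathbb R^{K\times P}$ and $\boldsymbol\Sigma$ a positive definite $P\times P$ matrix. Write $\boldsymbol\theta=\mathrm{vec}(\boldsymbol\Theta)$, $p(\mathbf Y|\mathbf X,\boldsymbol\Theta,\boldsymbol\Sigma)=\prod_i p(\mathbf y_i|\mathbf x_i,\boldsymbol\Theta,\boldsymbol\Sigma)$ for the likelihood and, for fractions $\mathbf b=(b_1,\dots,b_N)$ with all $b_i>0$, $p(\mathbf Y|\mathbf X,\boldsymbol\Theta,\boldsymbol\Sigma)^{\mathbf b}=\prod_i p(\mathbf y_i|\mathbf x_i,\boldsymbol\Theta,\boldsymbol\Sigma)^{b_i}$. Let $\mathbf Y_{\mathbf b},\mathbf X_{\mathbf b}$ have rows $\sqrt{b_i}\,\mathbf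 y_i'$ and $\sqrt{b_i}\,\mathbf x_i'$, and put $$\hat{\boldsymbol\Theta}=(\mathbf X'\mathbf X)^{-1}\mathbf X'\mathbf Y,\quad \mathbf S=(\mathbf Y-\mathbf X\hat{\boldsymbol\Theta})'(\mathbf Y-\mathbf X\hat{\boldsymbol\Theta}),\quad \hat{\boldsymbol\Theta}_{\mathbf b}=(\mathbf X_{\mathbf b}'\mathbf X_{\mathbf b})^{-1}\mathbf X_{\mathbf b}'\mathbf Y_{\mathbf b},\quad \mathbf S_{\mathbf b}=(\mathbf Y_{\mathbf b}-\mathbf X_{\mathbf b}\hat{\boldsymbol\Theta}_{\mathbf b})'(\mathbf Y_{\mathbf b}-\mathbf X_{\mathbf b}\hat{\boldsymbol\Theta}_{\mathbf b}).$$ Assume that $\mathbf X$ has full column rank, $\mathbf S$ is positive definite and $\sum_i b_i-K-P+1>0$. Let $M_t:\ \mathbf R_E\boldsymbol\theta=\mathbf r_E\ \&\ \mathbf R_O\boldsymbol\theta>\mathbf r_O$ be a constrained model, with $\mathbf R_E$ of full row rank and $\mathcal M_t=\{\boldsymbol\theta:\mathbf R_E\boldsymbol\theta=\mathbf r_E,\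 \mathbf R_O\boldsymbol\theta>\mathbf r_O\}\neq\emptyset$, let $M_u$ be the unconstrained model, and let $\boldsymbol\theta_0=\mathrm{vec}(\boldsymbol\Theta_0)$ satisfy $\mathbf R_E\boldsymbol\theta_0=\mathbf r_E$ and $\mathbf R_O\boldsymbol\theta_0=\mathbf r_O$. Put $\hat{\boldsymbol\theta}_{\mathbf b}=\mathrm{vec}(\hat{\boldsymbol\Theta}_{\mathbf b})$, $\mathcal M_t^*=\{\boldsymbol\theta:\mathbf R_E(\boldsymbol\theta-\hat{\boldsymbol\theta}_{\mathbf b})=\mathbf 0,\ \mathbf R_O(\boldsymbol\theta-\hat{\boldsymbol\theta}_{\mathbf b})>\mathbf 0\}$, and define the default marginal likelihoods $$p_t^*(\mathbf Y,\mathbf b)=\frac{\int_{\boldsymbol\Sigma}\int_{\boldsymbol\Theta\in\mathcal M_t}p(\mathbf Y|\mathbf X,\boldsymbol\Theta,\boldsymbol\Sigma)\,|\boldsymbol\Sigma|^{-\frac{P+1}2}d\boldsymbol\Theta\,d\boldsymbol\Sigma}{\int_{\boldsymbol\Sigma}\int_{\boldsymbol\Theta\in\mathcal M_t^*}p(\mathbf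 Y|\mathbf X,\boldsymbol\Theta,\boldsymbol\Sigma)^{\mathbf b}\,|\boldsymbol\Sigma|^{-\frac{P+1}2}d\boldsymbol\Theta\,d\boldsymbol\Sigma},\qquad p_u(\mathbf Y,\mathbf b)=\frac{\int_{\boldsymbol\Sigma}\int_{\boldsymbol\Theta}p(\mathbf Y|\mathbf X,\boldsymbol\Theta,\boldsymbol\Sigma)\,|\boldsymbol\Sigma|^{-\frac{P+1}2}d\boldsymbol\Theta\,d\boldsymbol\Sigma}{\int_{\boldsymbol\Sigma}\int_{\boldsymbol\Theta}p(\mathbf Y|\mathbf X,\boldsymbol\Theta,\boldsymbol\Sigma)^{\mathbf b}\,|\boldsymbol\Sigma|^{-\frac{P+1}2}d\boldsymbol\Theta\,d\boldsymbol\Sigma},$$ where $d\boldsymbol\Sigma$ is Lebesgue measure on symmetric matrices (restricted to the positive definite ones) and $d\boldsymbol\Theta$ is Lebesgue measure on the affine subspace cut out by the equality constraints. Let $B_{tu}=p_t^*(\mathbf Y,\mathbf b)/p_u(\mathbf Y,\mathbf b)$. Let $\pi_u(\boldsymbol\Theta|\mathbf Y,\mathbf X)$ and $\pi_u(\boldsymbol\Theta|\mathbf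 Y,\mathbf X,\mathbf b)$ be the $\boldsymbol\Theta$-marginals of the probability densities of $(\boldsymbol\Theta,\boldsymbol\Sigma)$ proportional to $p(\mathbf Y|\mathbf X,\boldsymbol\Theta,\boldsymbol\Sigma)|\boldsymbol\Sigma|^{-\frac{P+1}2}$ and $p(\mathbf Y|\mathbf X,\boldsymbol\Theta,\boldsymbol\Sigma)^{\mathbf b}|\boldsymbol\Sigma|^{-\frac{P+1}2}$, and let $\pi_u^*(\boldsymbol\Theta|\mathbf Y,\mathbf X,\mathbf b)=\pi_u(\boldsymbol\Theta+\hat{\boldsymbol\Theta}_{\mathbf b}-\boldsymbol\Theta_0|\mathbf Y,\mathbf X,\mathbf b)$ be the default prior. Let $f_t^E$ and $c_t^E$ be the marginal densities of $\mathbf R_E\boldsymbol\theta$ at $\mathbf r_E$, and $f_t^O$ and $c_t^O$ the conditional probabilities of $\mathbf R_O\boldsymbol\theta>\mathbf r_O$ given $\mathbf R_E\boldsymbol\theta=\mathbf r_E$, under $\pi_u(\cdot|\mathbf Y,\mathbf X)$ and $\pi_u^*(\cdot|\mathbf Y,\mathbf X,\mathbf b)$ respectively. These are computed from the joint density of $(\mathbf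 R_E\boldsymbol\theta,\mathbf D\boldsymbol\theta)$ by integrating out, and conditioning, in the coordinates $\mathbf D\boldsymbol\theta$, where $\mathbf D$ is any matrix that makes $[\mathbf R_E'\ \mathbf D']'$ square and nonsingular. Then all four integrals above are positive and finite, $f_t^E,c_t^E\in(0,\infty)$, $f_t^O,c_t^O\in(0,1]$, and $$B_{tu}=\frac{f_t^E}{c_t^E}\times\frac{f_t^O}{c_t^O}.$$ Moreover, for every $\boldsymbol\Theta$, $$\pi_u(\boldsymbol\Theta|\mathbf Y,\mathbf X)=\mathcal T_{K\times P}\bigl(\hat{\boldsymbol\Theta},(\mathbf X'\mathbf X)^{-1},\mathbf S,N-K-P+1\bigr),\qquad \pi_u^*(\boldsymbol\Theta|\mathbf Y,\mathbf X,\mathbf b)=\mathcal T_{K\times P}\bigl(\boldsymbol\Theta_0,(\mathbf X_{\mathbf b}'\mathbf X_{\mathbf b})^{-1},\mathbf S_{\mathbf b},\textstyle\sum_i b_i-K-P+1\bigr),$$ where $\mathcal T_{K\times P}(\mathbf M,\boldsymbol\Psi,\boldsymbol\Phi,\nu)$ is the matrix $t$ density $$\frac{\Gamma_P\bigl(\frac{\nu+K+P-1}2\bigr)}{\pi^{KP/2}\,\Gamma_P\bigl(\frac{\nu+P-1}2\bigr)}\,|\boldsymbol\Psi|^{-P/2}|\boldsymbol\Phi|^{-K/2}\,\bigl|\mathbf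 I_P+\boldsymbol\Phi^{-1}(\boldsymbol\Theta-\mathbf M)'\boldsymbol\Psi^{-1}(\boldsymbol\Theta-\mathbf M)\bigr|^{-\frac{\nu+K+P-1}2},\qquad \Gamma_P(a)=\pi^{P(P-1)/4}\prod_{j=1}^P\Gamma\bigl(a-\tfrac{j-1}2\bigr).$$ -/

import Mathlib

open MeasureTheory Matrix
open scoped ENNReal

noncomputable section

namespace MVLM

/-! ### Parameters -/

/-- Inverse of `Matrix.vec` (columns stacked): the `K × P` matrix with vectorization `v`. -/
def unvec {K P : ℕ} (v : Fin P × Fin K → ℝ) : Matrix (Fin K) (Fin P) ℝ :=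
  Matrix.of fun k p => v (p, k)

/-- The symmetric `P × P` matrix with free entries `s s(i, j)`. Lebesgue measure on
`Sym2 (Fin P) → ℝ` is the measure `dΣ = ∏_{i ≤ j} dσ_{ij}` on symmetric matrices. -/
def symMatrix {P : ℕ} (s : Sym2 (Fin P) → ℝ) : Matrix (Fin P) (Fin P) ℝ :=
  Matrix.of fun i j => s s(i, j)

/-- Coordinates of the positive definite (covariance) matrices. -/
def posDefCone (P : ℕ) : Set (Sym2 (Fin P) → ℝ) :=
  {s | (symMatrix s).PosDef}

/-! ### Likelihood -/

/-- Density at `y` of the `P`-variate normal distribution `N(m, Σ)`. -/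
def gaussDensity {P : ℕ} (m : Fin P → ℝ) (Sig : Matrix (Fin P) (Fin P) ℝ) (y : Fin P → ℝ) : ℝ :=
  (2 * Real.pi) ^ (-(P : ℝ) / 2) * Sig.det ^ (-(1 : ℝ) / 2) *
    Real.exp (-(1 / 2) * ((y - m) ⬝ᵥ (Sig⁻¹ *ᵥ (y - m))))

/-- Likelihood `p(Y | X, Θ, Σ)`, the rows `yᵢ` of `Y` being independent `N(Θ' xᵢ, Σ)`. -/
def likelihood {N K P : ℕ} (Y : Matrix (Fin N) (Fin P) ℝ) (X : Matrix (Fin N) (Fin K) ℝ)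
    (Th : Matrix (Fin K) (Fin P) ℝ) (Sig : Matrix (Fin P) (Fin P) ℝ) : ℝ :=
  ∏ i, gaussDensity (Thᵀ *ᵥ X i) Sig (Y i)

/-- Generalized fraction of the likelihood, `∏ᵢ p(yᵢ | xᵢ, Θ, Σ) ^ bᵢ`. -/
def fracLikelihood {N K P : ℕ} (b : Fin N → ℝ) (Y : Matrix (Fin N) (Fin P) ℝ)
    (X : Matrix (Fin N) (Fin K) ℝ)
    (Th : Matrix (Fin K) (Fin P) ℝ) (Sig : Matrix (Fin P) (Fin P) ℝ) : ℝ :=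
  ∏ i, gaussDensity (Thᵀ *ᵥ X i) Sig (Y i) ^ b i

/-- Independence Jeffreys prior `|Σ| ^ (-(P+1)/2)`. -/
def jeffreys {P : ℕ} (Sig : Matrix (Fin P) (Fin P) ℝ) : ℝ :=
  Sig.det ^ (-((P : ℝ) + 1) / 2)

/-! ### Least squares quantities -/

/-- `Θ̂ = (X'X)⁻¹ X'Y`. -/
def lsEst {N K P : ℕ} (Y : Matrix (Fin N) (Fin P) ℝ) (X : Matrix (Fin N) (Fin K) ℝ) :
    Matrix (Fin K) (Fin P) ℝ :=
  (Xᵀ * X)⁻¹ * Xᵀ * Y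

/-- `S = (Y - XΘ̂)'(Y - XΘ̂)`. -/
def sumSq {N K P : ℕ} (Y : Matrix (Fin N) (Fin P) ℝ) (X : Matrix (Fin N) (Fin K) ℝ) :
    Matrix (Fin P) (Fin P) ℝ :=
  (Y - X * lsEst Y X)ᵀ * (Y - X * lsEst Y X)

/-- The matrix `A_b` whose `i`-th row is `√bᵢ` times the `i`-th row of `A`. -/
def fracRows {N m : ℕ} (b : Fin N → ℝ) (A : Matrix (Fin N) (Fin m) ℝ) :
    Matrix (Fin N) (Fin m) ℝ :=
  Matrix.of fun i j => Real.sqrt (b i) * A i j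

/-! ### Matrix `t` distribution -/

/-- Multivariate gamma function `Γ_P(a)`. -/
def multiGamma (P : ℕ) (a : ℝ) : ℝ :=
  Real.pi ^ ((P : ℝ) * ((P : ℝ) - 1) / 4) * ∏ j : Fin P, Real.Gamma (a - (j : ℝ) / 2)

/-- Density of the matrix `t` distribution `T_{K×P}(M, Ψ, Φ, ν)` with location `M`, row scale `Ψ`,
column scale `Φ` and `ν` degrees of freedom. -/
def matrixTDensity {K P : ℕ} (M : Matrix (Fin K) (Fin P) ℝ) (Psi : Matrix (Fin K) (Fin K) ℝ)
    (Phi : Matrix (Fin P) (Fin P) ℝ) (nu : ℝ) (Th : Matrix (Fin K) (Fin P) ℝ) : ℝ :=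
  multiGamma P ((nu + K + P - 1) / 2) /
      (Real.pi ^ ((K : ℝ) * P / 2) * multiGamma P ((nu + P - 1) / 2)) *
    Psi.det ^ (-(P : ℝ) / 2) * Phi.det ^ (-(K : ℝ) / 2) *
    (1 + Phi⁻¹ * (Th - M)ᵀ * Psi⁻¹ * (Th - M)).det ^ (-(nu + K + P - 1) / 2)

/-! ### Constrained parameter spaces and marginal likelihoods -/

/-- `{θ | R_E θ = r_E, R_O θ > r_O}`. -/
def constrSet {K P qE qO : ℕ} (RE : Matrix (Fin qE) (Fin P × Fin K) ℝ) (rE : Fin qE → ℝ)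
    (RO : Matrix (Fin qO) (Fin P × Fin K) ℝ) (rO : Fin qO → ℝ) :
    Set (EuclideanSpace ℝ (Fin P × Fin K)) :=
  {θ | RE *ᵥ θ.ofLp = rE ∧ ∀ i, rO i < (RO *ᵥ θ.ofLp) i}

/-- `{θ | R_E (θ - vec C) = 0, R_O (θ - vec C) > 0}`. -/
def adjConstrSet {K P qE qO : ℕ} (RE : Matrix (Fin qE) (Fin P × Fin K) ℝ)
    (RO : Matrix (Fin qO) (Fin P × Fin K) ℝ) (C : Matrix (Fin K) (Fin P) ℝ) :
    Set (EuclideanSpace ℝ (Fin P × Fin K)) :=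
  {θ | RE *ᵥ (θ.ofLp - C.vec) = 0 ∧ ∀ i, 0 < (RO *ᵥ (θ.ofLp - C.vec)) i}

/-- `∫_Σ ∫_{Θ ∈ M} L(Θ, Σ) |Σ| ^ (-(P+1)/2) dΘ dΣ`, where `M` is a subset of a `d`-dimensional
affine subspace and `dΘ` is `d`-dimensional Lebesgue measure on that subspace. -/
def evidence {K P : ℕ} (d : ℕ) (M : Set (EuclideanSpace ℝ (Fin P × Fin K)))
    (L : Matrix (Fin K) (Fin P) ℝ → Matrix (Fin P) (Fin P) ℝ → ℝ) : ℝ≥0∞ :=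
  ∫⁻ s in posDefCone P, ∫⁻ θ in M,
    ENNReal.ofReal (L (unvec θ.ofLp) (symMatrix s) * jeffreys (symMatrix s))
      ∂(Measure.euclideanHausdorffMeasure d)

/-- Default marginal likelihood `p*_t(Y, b)` under the constrained model. The numerator integrates
the likelihood over the constrained space; the denominator integrates the fractional likelihood
over the constrained space moved so that its boundary passes through the least squares estimate
of that fractional likelihood. -/
def constrMargLik {N K P qE qO : ℕ} (Y : Matrix (Fin N) (Fin P) ℝ)
    (X : Matrix (Fin N) (Fin K) ℝ) (b : Fin N → ℝ)
    (RE : Matrix (Fin qE) (Fin P × Fin K) ℝ) (rE : Fin qE → ℝ)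
    (RO : Matrix (Fin qO) (Fin P × Fin K) ℝ) (rO : Fin qO → ℝ) : ℝ≥0∞ :=
  evidence (P * K - qE) (constrSet RE rE RO rO) (likelihood Y X) /
    evidence (P * K - qE) (adjConstrSet RE RO (lsEst (fracRows b Y) (fracRows b X)))
      (fracLikelihood b Y X)

/-- Marginal likelihood `p_u(Y, b)` under the unconstrained model. -/
def uncMargLik {N K P : ℕ} (Y : Matrix (Fin N) (Fin P) ℝ)
    (X : Matrix (Fin N) (Fin K) ℝ) (b : Fin N → ℝ) : ℝ≥0∞ :=
  evidence (P * K) Set.univ (likelihood Y X) / evidence (P * K) Set.univ (fracLikelihood b Y X)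

/-- Default Bayes factor `B_tu`. -/
def bayesFactor {N K P qE qO : ℕ} (Y : Matrix (Fin N) (Fin P) ℝ)
    (X : Matrix (Fin N) (Fin K) ℝ) (b : Fin N → ℝ)
    (RE : Matrix (Fin qE) (Fin P × Fin K) ℝ) (rE : Fin qE → ℝ)
    (RO : Matrix (Fin qO) (Fin P × Fin K) ℝ) (rO : Fin qO → ℝ) : ℝ≥0∞ :=
  constrMargLik Y X b RE rE RO rO / uncMargLik Y X b

/-! ### Unconstrained posterior and default prior of `Θ` -/

/-- Marginal density of `Θ` when the joint density of `(Θ, Σ)` is proportional to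
`L(Θ, Σ) |Σ| ^ (-(P+1)/2)`. -/
def thetaDensity {K P : ℕ} (L : Matrix (Fin K) (Fin P) ℝ → Matrix (Fin P) (Fin P) ℝ → ℝ)
    (Th : Matrix (Fin K) (Fin P) ℝ) : ℝ≥0∞ :=
  ∫⁻ s in posDefCone P,
    ENNReal.ofReal (L Th (symMatrix s) * jeffreys (symMatrix s)) / evidence (P * K) Set.univ L

/-- Unconstrained marginal posterior `π_u(Θ | Y, X)`. -/
def posterior {N K P : ℕ} (Y : Matrix (Fin N) (Fin P) ℝ) (X : Matrix (Fin N) (Fin K) ℝ) :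
    Matrix (Fin K) (Fin P) ℝ → ℝ≥0∞ :=
  thetaDensity (likelihood Y X)

/-- Default prior `π*_u(Θ | Y, X, b)`: the fractional prior `π_u(Θ | Y, X, b)` translated so that
its location moves from the least squares estimate to `Θ₀`. -/
def defaultPrior {N K P : ℕ} (Y : Matrix (Fin N) (Fin P) ℝ) (X : Matrix (Fin N) (Fin K) ℝ)
    (b : Fin N → ℝ) (Th0 : Matrix (Fin K) (Fin P) ℝ) :
    Matrix (Fin K) (Fin P) ℝ → ℝ≥0∞ :=
  fun Th => thetaDensity (fracLikelihood b Y X)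
    (Th + lsEst (fracRows b Y) (fracRows b X) - Th0)

/-! ### Marginal and conditional distributions in the coordinates `ζ = (R_E θ, D θ)` -/

/-- The square matrix `H = [R_E' D']'`, its rows listed in the order given by `e`. -/
def coordMatrix {K P qE d : ℕ} (RE : Matrix (Fin qE) (Fin P × Fin K) ℝ)
    (D : Matrix (Fin d) (Fin P × Fin K) ℝ) (e : Fin qE ⊕ Fin d ≃ Fin P × Fin K) :
    Matrix (Fin P × Fin K) (Fin P × Fin K) ℝ :=
  (Matrix.fromRows RE D).submatrix e.symm id

/-- `θ = H⁻¹ ζ` for `ζ = (ζ_E, ζ_O)`. -/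
def thetaOf {K P qE d : ℕ} (RE : Matrix (Fin qE) (Fin P × Fin K) ℝ)
    (D : Matrix (Fin d) (Fin P × Fin K) ℝ) (e : Fin qE ⊕ Fin d ≃ Fin P × Fin K)
    (zE : Fin qE → ℝ) (zO : Fin d → ℝ) : Fin P × Fin K → ℝ :=
  (coordMatrix RE D e)⁻¹ *ᵥ (Sum.elim zE zO ∘ e.symm)

/-- Joint density of `(ζ_E, ζ_O) = Hθ` when `Θ` has density `π`. -/
def zetaDensity {K P qE d : ℕ} (RE : Matrix (Fin qE) (Fin P × Fin K) ℝ)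
    (D : Matrix (Fin d) (Fin P × Fin K) ℝ) (e : Fin qE ⊕ Fin d ≃ Fin P × Fin K)
    (π : Matrix (Fin K) (Fin P) ℝ → ℝ≥0∞) (zE : Fin qE → ℝ) (zO : Fin d → ℝ) : ℝ≥0∞ :=
  ENNReal.ofReal (|(coordMatrix RE D e).det|⁻¹) * π (unvec (thetaOf RE D e zE zO))

/-- Marginal density of `ζ_E = R_E θ` at `zE`. -/
def margDensity {K P qE d : ℕ} (RE : Matrix (Fin qE) (Fin P × Fin K) ℝ)
    (D : Matrix (Fin d) (Fin P × Fin K) ℝ) (e : Fin qE ⊕ Fin d ≃ Fin P × Fin K)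
    (π : Matrix (Fin K) (Fin P) ℝ → ℝ≥0∞) (zE : Fin qE → ℝ) : ℝ≥0∞ :=
  ∫⁻ zO, zetaDensity RE D e π zE zO

/-- Conditional probability of `R_O θ > r_O` given `R_E θ = zE`, the conditional density of `ζ_O`
being the ratio of joint to marginal density. -/
def condProb {K P qE qO d : ℕ} (RE : Matrix (Fin qE) (Fin P × Fin K) ℝ)
    (D : Matrix (Fin d) (Fin P × Fin K) ℝ) (e : Fin qE ⊕ Fin d ≃ Fin P × Fin K)
    (RO : Matrix (Fin qO) (Fin P × Fin K) ℝ) (rO : Fin qO → ℝ)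
    (π : Matrix (Fin K) (Fin P) ℝ → ℝ≥0∞) (zE : Fin qE → ℝ) : ℝ≥0∞ :=
  ∫⁻ zO in {zO | ∀ i, rO i < (RO *ᵥ thetaOf RE D e zE zO) i},
    zetaDensity RE D e π zE zO / margDensity RE D e π zE

end MVLM

end

noncomputable section

namespace MVLM

/-! ### Gaussian and inverse gamma integrals -/

/-! Everything reduces to one function of Θ, the weight `thetaWeight` obtained by integrating Σ out.
For fixed Θ, the fractional likelihood times the Jeffreys prior is an unnormalized inverse Wishart
density in Σ (`fracLikelihood_mul_jeffreys`), whose scale is half of Q(Θ) = S_b + (Θ - Θ̂_b)'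
X_b'X_b (Θ - Θ̂_b). Hence the weight is a constant times |Q(Θ)|^(-n/2) with n = ∑ b_i. The full
likelihood is the case b = 1, so each fact is proved once for general b.

The inverse Wishart constant (`lintegral_invWishart`) comes by induction on P: in Schur complement
coordinates the density splits into a Gaussian integral, an inverse gamma integral and an inverse
Wishart density of size P. Integrating in the other order, first Θ (matrix normal) and then Σ, gives
the unconstrained evidence Z (`evidence_univ`); the quotient of weight and Z is the matrix t density
(`thetaDensity_fracLikelihood`).

For the Bayes factor, the point Θ₀ lies on all constraint boundaries, so the adjusted space is the
constrained space translated by Θ̂_b - Θ₀. Translating back, the denominator of the constrained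
marginal likelihood integrates over the original constrained space a weight proportional to the
default prior. In the coordinates Dθ each constrained evidence is κ times an integral I of a weight
over the same region, with the same Hausdorff factor κ (`evidence_translate`), while the marginal
density times the conditional probability is J · I / Z with the same Jacobian J
(`margDensity_condProb`). Both κ and J cancel in the ratio (`ratio_eq_of_mul_eq`).

Finiteness on a slice R_E θ = r_E, a null set when there are equality constraints, does not follow
from finiteness of Z alone. Tonelli makes almost every slice integral finite, and the comparison of
Q at Θ and Θ + Δ (`exists_thetaWeight_le`) carries finiteness from one slice to all others. -/

open scoped MatrixOrder in
/-- A positive semidefinite real matrix is `Cᵀ * C` for some `C`. -/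
lemma exists_transpose_mul_self {ι : Type*} [Fintype ι] [DecidableEq ι] {M : Matrix ι ι ℝ}
    (hM : M.PosSemidef) : ∃ C : Matrix ι ι ℝ, M = Cᵀ * C := by
  refine ⟨CFC.sqrt M, ?_⟩
  have h : (CFC.sqrt M).PosSemidef := nonneg_iff_posSemidef.mp (CFC.sqrt_nonneg M)
  have h2 : (CFC.sqrt M)ᵀ = CFC.sqrt M := by
    simpa [IsHermitian, conjTranspose_eq_transpose_of_trivial] using h.isHermitian
  rw [h2, CFC.sqrt_mul_sqrt_self M (nonneg_iff_posSemidef.mpr hM)]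

/-- Linear change of variables for Lebesgue integrals of nonnegative functions. -/
lemma lintegral_comp_mulVec {ι : Type*} [Fintype ι] [DecidableEq ι] {M : Matrix ι ι ℝ}
    (hM : M.det ≠ 0) (f : (ι → ℝ) → ℝ≥0∞) :
    ∫⁻ x, f x = ENNReal.ofReal |M.det| * ∫⁻ u, f (M *ᵥ u) := by
  let e : (ι → ℝ) ≃ₗ[ℝ] (ι → ℝ) := Matrix.toLinearEquiv' M (M.invertibleOfIsUnitDet hM.isUnit)
  have he : MeasurableEmbedding (toLin' M) :=
    e.toContinuousLinearEquiv.toHomeomorph.measurableEmbedding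
  have h := Real.map_matrix_volume_pi_eq_smul_volume_pi hM
  have h1 : ∫⁻ u, f (M *ᵥ u) = ENNReal.ofReal |M.det⁻¹| * ∫⁻ x, f x := by
    rw [← smul_eq_mul, ← lintegral_smul_measure, ← h, he.lintegral_map]
    rfl
  rw [h1, ← mul_assoc, ← ENNReal.ofReal_mul (abs_nonneg _), ← abs_mul, mul_inv_cancel₀ hM]
  simp

lemma lintegral_exp_neg_dotProduct_self (ι : Type*) [Fintype ι] :
    ∫⁻ u : ι → ℝ, ENNReal.ofReal (Real.exp (-(u ⬝ᵥ u))) =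
      ENNReal.ofReal (Real.pi ^ ((Fintype.card ι : ℝ) / 2)) := by
  have h1 : ∀ u : ι → ℝ, Real.exp (-(u ⬝ᵥ u)) = ∏ i, Real.exp (-1 * u i ^ 2) := fun u => by
    rw [← Real.exp_sum]
    simp [dotProduct, pow_two]
  simp_rw [h1]
  rw [← ofReal_integral_eq_lintegral_ofReal]
  · rw [integral_fintype_prod_volume_eq_pow (fun x : ℝ => Real.exp (-1 * x ^ 2)),
      integral_gaussian, div_one, Real.sqrt_eq_rpow, ← Real.rpow_natCast,
      ← Real.rpow_mul Real.pi_pos.le]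
    congr 2
    ring
  · exact Integrable.fintype_prod fun _ => integrable_exp_neg_mul_sq one_pos
  · exact Filter.Eventually.of_forall fun u => Finset.prod_nonneg fun i _ => (Real.exp_pos _).le

/-- The multivariate Gaussian integral. -/
lemma lintegral_exp_neg_quadratic {ι : Type*} [Fintype ι] [DecidableEq ι] {M : Matrix ι ι ℝ}
    (hM : M.PosDef) (m : ι → ℝ) :
    ∫⁻ u, ENNReal.ofReal (Real.exp (-((u - m) ⬝ᵥ (M *ᵥ (u - m))))) =
      ENNReal.ofReal (Real.pi ^ ((Fintype.card ι : ℝ) / 2) * M.det ^ (-(1 : ℝ) / 2)) := by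
  rw [lintegral_sub_right_eq_self
    (fun u : ι → ℝ => ENNReal.ofReal (Real.exp (-(u ⬝ᵥ (M *ᵥ u))))) m]
  obtain ⟨C, rfl⟩ := exists_transpose_mul_self hM.posSemidef
  have hd := hM.det_pos
  rw [det_mul, det_transpose] at hd
  have hC : C.det ≠ 0 := fun h => by simp [h] at hd
  have h1 : ∀ u : ι → ℝ, u ⬝ᵥ ((Cᵀ * C) *ᵥ u) = (C *ᵥ u) ⬝ᵥ (C *ᵥ u) := fun u => by
    rw [← mulVec_mulVec, dotProduct_mulVec, vecMul_transpose]
  have h2 := lintegral_comp_mulVec hC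
    (fun u : ι → ℝ => ENNReal.ofReal (Real.exp (-(u ⬝ᵥ u))))
  rw [lintegral_exp_neg_dotProduct_self] at h2
  simp_rw [h1]
  have habs : 0 < |C.det| := abs_pos.mpr hC
  have h3 : (Cᵀ * C).det ^ (-(1 : ℝ) / 2) = |C.det|⁻¹ := by
    rw [det_mul, det_transpose, ← abs_mul_abs_self, ← pow_two, ← Real.rpow_natCast,
      ← Real.rpow_mul habs.le]
    norm_num [Real.rpow_neg_one]
  rw [h3, ENNReal.ofReal_mul (by positivity), h2, mul_comm, ← mul_assoc,
    ← ENNReal.ofReal_mul (by positivity), inv_mul_cancel₀ habs.ne']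
  simp

/-- The inverse gamma integral. -/
lemma lintegral_rpow_mul_exp_neg_div {a δ : ℝ} (ha : 0 < a) (hδ : 0 < δ) :
    ∫⁻ t in Set.Ioi (0 : ℝ), ENNReal.ofReal (t ^ (-a - 1) * Real.exp (-(δ / t))) =
      ENNReal.ofReal (Real.Gamma a * δ ^ (-a)) := by
  have hne : (-1 : ℝ) ≠ 0 := by norm_num
  -- The substitution t ↦ t⁻¹ turns the integrand into this gamma integrand.
  set g : ℝ → ℝ := fun t => t ^ (a - 1) * Real.exp (-(δ * t)) with hg
  have hgi := Real.integral_rpow_mul_exp_neg_mul_Ioi ha hδ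
  -- A nonintegrable function would have Bochner integral 0, but the gamma integral is positive.
  have hgint : IntegrableOn g (Set.Ioi 0) := by
    by_contra h
    rw [integral_undef h] at hgi
    have := Real.Gamma_pos_of_pos ha
    have : 0 < (1 / δ) ^ a * Real.Gamma a := by positivity
    linarith
  have heq : ∀ t ∈ Set.Ioi (0 : ℝ), t ^ (-a - 1) * Real.exp (-(δ / t)) =
      (|(-1 : ℝ)| * t ^ ((-1 : ℝ) - 1)) • g (t ^ (-1 : ℝ)) := by
    intro t ht
    have ht : 0 < t := ht
    simp only [hg, smul_eq_mul, abs_neg, abs_one, one_mul]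
    rw [← Real.rpow_mul ht.le, ← mul_assoc, ← Real.rpow_add ht, Real.rpow_neg_one, div_eq_mul_inv]
    congr 2
    ring
  rw [setLIntegral_congr_fun measurableSet_Ioi (fun t ht => by rw [heq t ht]),
    ← ofReal_integral_eq_lintegral_ofReal]
  · rw [integral_comp_rpow_Ioi g hne, hgi, one_div, Real.inv_rpow hδ.le, Real.rpow_neg hδ.le,
      mul_comm]
  · exact (integrableOn_Ioi_comp_rpow_iff g hne).mpr hgint
  · filter_upwards [self_mem_ae_restrict measurableSet_Ioi] with t ht
    have ht : 0 < t := ht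
    simp only [hg, smul_eq_mul, Pi.zero_apply]
    positivity

/-! ### Block decomposition of symmetric matrices -/

/-- The symmetric block matrix `L diag(B, t) Lᵀ` with `L = [1 0; uᵀ 1]`. -/
def blockMatrix {P : ℕ} (B : Matrix (Fin P) (Fin P) ℝ) (u : Fin P → ℝ) (t : ℝ) :
    Matrix (Fin P ⊕ Fin 1) (Fin P ⊕ Fin 1) ℝ :=
  fromBlocks B (replicateCol (Fin 1) (B *ᵥ u)) (replicateRow (Fin 1) (B *ᵥ u))
    (of fun _ _ => t + u ⬝ᵥ (B *ᵥ u))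

/-- The unit lower triangular block matrix `[1 0; uᵀ 1]`. -/
def lowerBlock {P : ℕ} (u : Fin P → ℝ) : Matrix (Fin P ⊕ Fin 1) (Fin P ⊕ Fin 1) ℝ :=
  fromBlocks 1 0 (replicateRow (Fin 1) u) 1

/-- These matrices form a copy of the additive group of vectors; inverting and recentring block
matrices both rest on this. -/
lemma lowerBlock_mul {P : ℕ} (u v : Fin P → ℝ) :
    lowerBlock u * lowerBlock v = lowerBlock (u + v) := by
  simp [lowerBlock, fromBlocks_multiply, replicateRow_add]

lemma lowerBlock_zero {P : ℕ} : lowerBlock (0 : Fin P → ℝ) = 1 := by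
  rw [lowerBlock, ← fromBlocks_one]
  congr

lemma det_lowerBlock {P : ℕ} (u : Fin P → ℝ) : (lowerBlock u).det = 1 := by
  simp [lowerBlock]

lemma blockMatrix_eq {P : ℕ} {B : Matrix (Fin P) (Fin P) ℝ} (hB : Bᵀ = B) (u : Fin P → ℝ)
    (t : ℝ) : blockMatrix B u t =
      lowerBlock u * fromBlocks B 0 0 (of fun _ _ => t) * (lowerBlock u)ᵀ := by
  have h1 : u ᵥ* B = B *ᵥ u := by
    conv_lhs => rw [← hB, vecMul_transpose]
  have h2 : replicateRow (Fin 1) u * B = replicateRow (Fin 1) (B *ᵥ u) := by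
    rw [← h1, replicateRow_vecMul]
  have h3 : B * replicateCol (Fin 1) u = replicateCol (Fin 1) (B *ᵥ u) := by
    rw [replicateCol_mulVec]
  simp only [blockMatrix, lowerBlock, fromBlocks_transpose, fromBlocks_multiply, transpose_one,
    transpose_zero, transpose_replicateRow, Matrix.one_mul, Matrix.mul_one, Matrix.zero_mul,
    Matrix.mul_zero, add_zero, zero_add, h2, h3]
  congr 1
  ext i j
  simp [mul_apply, dotProduct, mul_comm, add_comm]

lemma posDef_fromBlocks_diag_iff {P : ℕ} {B : Matrix (Fin P) (Fin P) ℝ} {t : ℝ} :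
    (fromBlocks B 0 0 (of fun _ _ => t) : Matrix (Fin P ⊕ Fin 1) (Fin P ⊕ Fin 1) ℝ).PosDef ↔
      B.PosDef ∧ 0 < t := by
  constructor
  · intro h
    refine ⟨by simpa using! h.submatrix (e := Sum.inl) Sum.inl_injective, ?_⟩
    simpa using! h.diag_pos (i := Sum.inr 0)
  · rintro ⟨hB, ht⟩
    rw [posDef_iff_dotProduct_mulVec]
    refine ⟨?_, fun x hx => ?_⟩
    · rw [IsHermitian, fromBlocks_conjTranspose, hB.isHermitian.eq]
      congr 1
    · obtain ⟨y, z, rfl⟩ : ∃ y z, x = Sum.elim y z := ⟨x ∘ Sum.inl, x ∘ Sum.inr, by simp⟩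
      have hz : z ⬝ᵥ ((of fun _ _ => t : Matrix (Fin 1) (Fin 1) ℝ) *ᵥ z) = t * z 0 ^ 2 := by
        simp [dotProduct, mulVec]
        ring
      have e1 : star (Sum.elim y z) ⬝ᵥ ((fromBlocks B 0 0 (of fun _ _ => t) :
          Matrix (Fin P ⊕ Fin 1) (Fin P ⊕ Fin 1) ℝ) *ᵥ Sum.elim y z) =
          y ⬝ᵥ (B *ᵥ y) + t * z 0 ^ 2 := by
        rw [← hz, fromBlocks_mulVec]
        simp [dotProduct]
      rw [e1]
      by_cases hy : y = 0
      · have hz0 : z 0 ≠ 0 := by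
          intro h0
          apply hx
          ext (i | i)
          · simp [hy]
          · simp [Subsingleton.elim i 0, h0]
        simp only [hy, zero_dotProduct, zero_add]
        positivity
      · have := hB.dotProduct_mulVec_pos hy
        simp only [star_trivial] at this
        positivity

/-- Congruence by an invertible matrix preserves definiteness, so only the block diagonal part
matters. In the coordinates (B, u, t) the cone becomes a product, with u free. -/
lemma posDef_blockMatrix_iff {P : ℕ} {B : Matrix (Fin P) (Fin P) ℝ} (hB : Bᵀ = B)
    {u : Fin P → ℝ} {t : ℝ} : (blockMatrix B u t).PosDef ↔ B.PosDef ∧ 0 < t := by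
  have hU : IsUnit (lowerBlock u) := by
    rw [isUnit_iff_isUnit_det, det_lowerBlock]
    exact isUnit_one
  have h := hU.posDef_star_right_conjugate_iff (x := fromBlocks B 0 0 (of fun _ _ => t))
  rw [star_eq_conjTranspose, conjTranspose_eq_transpose_of_trivial] at h
  rw [blockMatrix_eq hB, h, posDef_fromBlocks_diag_iff]

lemma det_blockMatrix {P : ℕ} {B : Matrix (Fin P) (Fin P) ℝ} (hB : Bᵀ = B)
    (u : Fin P → ℝ) (t : ℝ) : (blockMatrix B u t).det = B.det * t := by
  rw [blockMatrix_eq hB, det_mul, det_mul, det_transpose, det_lowerBlock, det_fromBlocks_zero₂₁]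
  simp

lemma inv_blockMatrix {P : ℕ} {B : Matrix (Fin P) (Fin P) ℝ} (hB : B.PosDef)
    (u : Fin P → ℝ) {t : ℝ} (ht : 0 < t) : (blockMatrix B u t)⁻¹ =
      (lowerBlock (-u))ᵀ * fromBlocks B⁻¹ 0 0 (of fun _ _ => t⁻¹) * lowerBlock (-u) := by
  have hT : Bᵀ = B := by simpa [conjTranspose_eq_transpose_of_trivial] using hB.isHermitian.eq
  apply inv_eq_right_inv
  have h1 : (lowerBlock u)ᵀ * (lowerBlock (-u))ᵀ = 1 := by
    rw [← transpose_mul, lowerBlock_mul, neg_add_cancel, lowerBlock_zero, transpose_one]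
  have h2 : (fromBlocks B 0 0 (of fun _ _ => t) : Matrix (Fin P ⊕ Fin 1) (Fin P ⊕ Fin 1) ℝ) *
      fromBlocks B⁻¹ 0 0 (of fun _ _ => t⁻¹) = 1 := by
    rw [fromBlocks_multiply, ← fromBlocks_one]
    congr 1
    · simp [mul_nonsing_inv B hB.det_pos.ne'.isUnit]
    · simp
    · simp
    · ext i j
      obtain rfl := Subsingleton.elim i j
      simp [mul_apply, ht.ne']
  calc blockMatrix B u t *
        ((lowerBlock (-u))ᵀ * fromBlocks B⁻¹ 0 0 (of fun _ _ => t⁻¹) * lowerBlock (-u))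
      = lowerBlock u * (fromBlocks B 0 0 (of fun _ _ => t) *
          ((lowerBlock u)ᵀ * (lowerBlock (-u))ᵀ) * fromBlocks B⁻¹ 0 0 (of fun _ _ => t⁻¹)) *
          lowerBlock (-u) := by
        rw [blockMatrix_eq hT]
        simp only [Matrix.mul_assoc]
    _ = 1 := by
        rw [h1, Matrix.mul_one, h2, Matrix.mul_one, lowerBlock_mul, add_neg_cancel,
          lowerBlock_zero]

/-- By cyclicity of the trace, the triangular factors of the inverse act on the second matrix, where
they only move m to m - u. What remains is paired with a block diagonal matrix, which separates the
leading block from the corner. -/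
lemma trace_inv_blockMatrix_mul {P : ℕ} {B A : Matrix (Fin P) (Fin P) ℝ} (hB : B.PosDef)
    (hA : Aᵀ = A) (u m : Fin P → ℝ) {t : ℝ} (ht : 0 < t) (δ : ℝ) :
    ((blockMatrix B u t)⁻¹ * blockMatrix A m δ).trace =
      (B⁻¹ * A).trace + (δ + (u - m) ⬝ᵥ (A *ᵥ (u - m))) / t := by
  have h : (lowerBlock (-u)) * blockMatrix A m δ * (lowerBlock (-u))ᵀ =
      blockMatrix A (m - u) δ := by
    have e : m - u = -u + m := by abel
    rw [e, blockMatrix_eq hA, blockMatrix_eq hA, ← lowerBlock_mul, transpose_mul]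
    simp only [Matrix.mul_assoc]
  rw [inv_blockMatrix hB u ht, Matrix.mul_assoc, Matrix.mul_assoc, trace_mul_comm,
    Matrix.mul_assoc, h, blockMatrix, fromBlocks_multiply, trace]
  have e2 : (m - u) ⬝ᵥ (A *ᵥ (m - u)) = (u - m) ⬝ᵥ (A *ᵥ (u - m)) := by
    rw [← neg_sub u m, mulVec_neg, neg_dotProduct, dotProduct_neg, neg_neg]
  simp [e2, trace, mul_apply]
  field_simp

/-- Solving A₁ m = α for the off-diagonal column α leaves the Schur complement δ in the corner. -/
lemma exists_eq_blockMatrix {P : ℕ} {A : Matrix (Fin (P + 1)) (Fin (P + 1)) ℝ} (hA : A.PosDef) :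
    ∃ (A₁ : Matrix (Fin P) (Fin P) ℝ) (m : Fin P → ℝ) (δ : ℝ), A₁.PosDef ∧ 0 < δ ∧
      A.submatrix finSumFinEquiv finSumFinEquiv = blockMatrix A₁ m δ := by
  set A' := A.submatrix finSumFinEquiv finSumFinEquiv with hA'
  have hp : A'.PosDef := hA.submatrix finSumFinEquiv.injective
  have h1 : A'.toBlocks₁₁.PosDef := hp.submatrix (e := Sum.inl) Sum.inl_injective
  have hT : A'.toBlocks₁₁ᵀ = A'.toBlocks₁₁ := by
    simpa [conjTranspose_eq_transpose_of_trivial] using h1.isHermitian.eq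
  set α : Fin P → ℝ := fun i => A' (Sum.inl i) (Sum.inr 0)
  set m := A'.toBlocks₁₁⁻¹ *ᵥ α with hm
  have hmul : A'.toBlocks₁₁ *ᵥ m = α := by
    rw [hm, mulVec_mulVec, mul_nonsing_inv _ h1.det_pos.ne'.isUnit, one_mulVec]
  have heq : A' = blockMatrix A'.toBlocks₁₁ m (A' (Sum.inr 0) (Sum.inr 0) - m ⬝ᵥ α) := by
    rw [blockMatrix, hmul, sub_add_cancel]
    ext (i | i) (j | j)
    · rfl
    · simp [α, Subsingleton.elim j 0]
    · rw [← hp.isHermitian.apply]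
      simp [α, Subsingleton.elim i 0]
    · simp [Subsingleton.elim i 0, Subsingleton.elim j 0]
  refine ⟨_, _, _, h1, ?_, heq⟩
  rw [heq] at hp
  exact ((posDef_blockMatrix_iff hT).mp hp).2

/-! ### Lebesgue measure on symmetric matrices -/

lemma symMatrix_transpose {P : ℕ} (s : Sym2 (Fin P) → ℝ) : (symMatrix s)ᵀ = symMatrix s := by
  ext i j
  simp [symMatrix, Sym2.eq_swap]

/-- An unordered pair in `Fin (P + 1)` is a pair in `Fin P`, a pair `{i, last}` with `i` in `Fin P`,
or `{last, last}`. -/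
def sym2Join (P : ℕ) : Sym2 (Fin P) ⊕ (Fin P ⊕ Unit) → Sym2 (Fin (P + 1)) :=
  Sum.elim (Sym2.map Fin.castSucc)
    (Sum.elim (fun i => s(i.castSucc, Fin.last P)) fun _ => s(Fin.last P, Fin.last P))

lemma sym2Join_bijective (P : ℕ) : Function.Bijective (sym2Join P) := by
  have hlast : ∀ i : Fin P, i.castSucc ≠ Fin.last P := fun i => Fin.castSucc_ne_last i
  have hlast' : ∀ i : Fin P, Fin.last P ≠ i.castSucc := fun i => (hlast i).symm
  constructor
  · rintro (x | x | x) (y | y | y) h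
    · exact congrArg Sum.inl (Sym2.map.injective (Fin.castSucc_injective P) h)
    · induction x with | _ a b => simp [sym2Join, hlast] at h
    · induction x with | _ a b => simp [sym2Join, hlast] at h
    · induction y with | _ a b => simp [sym2Join, hlast'] at h
    · simp [sym2Join, hlast] at h
      simp [h]
    · simp [sym2Join, hlast] at h
    · induction y with | _ a b => simp [sym2Join, hlast'] at h
    · simp [sym2Join, hlast'] at h
    · rfl
  · intro z
    induction z with | _ a b =>
    induction a using Fin.lastCases with
    | last =>
      induction b using Fin.lastCases with
      | last => exact ⟨Sum.inr (Sum.inr ()), rfl⟩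
      | cast j => exact ⟨Sum.inr (Sum.inl j), Sym2.eq_swap⟩
    | cast i =>
      induction b using Fin.lastCases with
      | last => exact ⟨Sum.inr (Sum.inl i), rfl⟩
      | cast j => exact ⟨Sum.inl s(i, j), rfl⟩

/-- `sym2Join` as an equivalence. -/
def sym2Equiv (P : ℕ) : Sym2 (Fin P) ⊕ (Fin P ⊕ Unit) ≃ Sym2 (Fin (P + 1)) :=
  Equiv.ofBijective _ (sym2Join_bijective P)

/-- Coordinates of the symmetric matrix with leading block `s`, last column `v` and corner `c`. -/
def blockCoords {P : ℕ} (s : Sym2 (Fin P) → ℝ) (v : Fin P → ℝ) (c : ℝ) :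
    Sym2 (Fin (P + 1)) → ℝ :=
  Sum.elim s (Sum.elim v fun _ => c) ∘ (sym2Equiv P).symm

lemma symMatrix_blockCoords {P : ℕ} (s : Sym2 (Fin P) → ℝ) (v : Fin P → ℝ) (c : ℝ) :
    (symMatrix (blockCoords s v c)).submatrix finSumFinEquiv finSumFinEquiv =
      fromBlocks (symMatrix s) (replicateCol (Fin 1) v) (replicateRow (Fin 1) v)
        (of fun _ _ => c) := by
  have key : ∀ z, blockCoords s v c (sym2Join P z) = Sum.elim s (Sum.elim v fun _ => c) z :=
    fun z => congrArg _ ((sym2Equiv P).symm_apply_apply z)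
  ext (i | i) (j | j)
  · exact key (Sum.inl s(i, j))
  · rw [Subsingleton.elim j 0]
    exact key (Sum.inr (Sum.inl i))
  · rw [Subsingleton.elim i 0]
    refine Eq.trans ?_ (key (Sum.inr (Sum.inl j)))
    exact congrArg (blockCoords s v c) Sym2.eq_swap
  · rw [Subsingleton.elim i 0, Subsingleton.elim j 0]
    exact key (Sum.inr (Sum.inr ()))

/-- Tonelli after reindexing the free entries; it sets up the induction on the size of the matrix.
-/
lemma lintegral_sym_succ {P : ℕ} {f : (Sym2 (Fin (P + 1)) → ℝ) → ℝ≥0∞} (hf : Measurable f) :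
    ∫⁻ x, f x = ∫⁻ s, ∫⁻ v, ∫⁻ c, f (blockCoords s v c) := by
  have m1 := volume_measurePreserving_piCongrLeft (fun _ => ℝ) (sym2Equiv P)
  have m2 := volume_measurePreserving_sumPiEquivProdPi_symm
    (fun _ : Sym2 (Fin P) ⊕ (Fin P ⊕ Unit) => ℝ)
  have m3 := volume_measurePreserving_sumPiEquivProdPi_symm (fun _ : Fin P ⊕ Unit => ℝ)
  have m4 := (volume_preserving_funUnique Unit ℝ).symm
  have key : ∀ s v c, MeasurableEquiv.piCongrLeft (fun _ => ℝ) (sym2Equiv P)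
      ((MeasurableEquiv.sumPiEquivProdPi fun _ : Sym2 (Fin P) ⊕ (Fin P ⊕ Unit) => ℝ).symm
        (s, (MeasurableEquiv.sumPiEquivProdPi fun _ : Fin P ⊕ Unit => ℝ).symm
          (v, (MeasurableEquiv.funUnique Unit ℝ).symm c))) = blockCoords s v c := by
    intro s v c
    ext z
    obtain ⟨y, rfl⟩ := (sym2Equiv P).surjective z
    rw [MeasurableEquiv.coe_piCongrLeft, Equiv.piCongrLeft_apply_apply, blockCoords,
      Function.comp_apply, Equiv.symm_apply_apply]
    rcases y with y | y | y <;> rfl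
  rw [← m1.lintegral_comp hf,
    ← m2.lintegral_comp (f := fun x => f (MeasurableEquiv.piCongrLeft (fun _ => ℝ) (sym2Equiv P) x))
      (by fun_prop), Measure.volume_eq_prod,
    lintegral_prod _ (by fun_prop)]
  refine lintegral_congr fun s => ?_
  rw [← m3.lintegral_comp (by fun_prop), Measure.volume_eq_prod, lintegral_prod _ (by fun_prop)]
  refine lintegral_congr fun v => ?_
  rw [← m4.lintegral_comp (by fun_prop)]
  simp_rw [key]

/-! ### The inverse Wishart integral -/

lemma continuous_symMatrix {P : ℕ} :
    Continuous (symMatrix : (Sym2 (Fin P) → ℝ) → Matrix (Fin P) (Fin P) ℝ) :=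
  continuous_matrix fun i j => continuous_apply s(i, j)

@[fun_prop]
lemma measurable_det_symMatrix {P : ℕ} :
    Measurable fun s : Sym2 (Fin P) → ℝ => (symMatrix s).det :=
  (continuous_symMatrix.matrix_det).measurable

@[fun_prop]
lemma measurable_inv_symMatrix {P : ℕ} (i j : Fin P) :
    Measurable fun s : Sym2 (Fin P) → ℝ => (symMatrix s)⁻¹ i j := by
  simp_rw [Matrix.inv_def, Ring.inverse_eq_inv', Matrix.smul_apply, smul_eq_mul]
  exact (measurable_det_symMatrix.inv).mul
    (continuous_symMatrix.matrix_adjugate.matrix_elem i j).measurable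

/-- Positive definite means positive semidefinite with nonzero determinant. Semidefiniteness is an
uncountable intersection of closed conditions, hence closed; the determinant condition is open. -/
lemma measurableSet_posDefCone (P : ℕ) : MeasurableSet (posDefCone P) := by
  have h : posDefCone P = (⋂ x : Fin P → ℝ, {s | 0 ≤ x ⬝ᵥ (symMatrix s *ᵥ x)}) ∩
      {s | (symMatrix s).det ≠ 0} := by
    ext s
    have hH : (symMatrix s).IsHermitian := by
      rw [IsHermitian, conjTranspose_eq_transpose_of_trivial, symMatrix_transpose]
    simp only [posDefCone, Set.mem_ofPred_eq, Set.mem_inter_iff, Set.mem_iInter]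
    constructor
    · intro hs
      exact ⟨fun x => by simpa using hs.posSemidef.dotProduct_mulVec_nonneg x, hs.det_pos.ne'⟩
    · rintro ⟨h1, h2⟩
      have hp : (symMatrix s).PosSemidef :=
        .of_dotProduct_mulVec_nonneg hH fun x => by simpa using h1 x
      exact hp.posDef_iff_det_ne_zero.mpr h2
  rw [h]
  refine (IsClosed.measurableSet (isClosed_iInter fun x => ?_)).inter ?_
  · exact isClosed_le continuous_const
      (continuous_const.dotProduct (continuous_symMatrix.matrix_mulVec continuous_const))
  · exact (isOpen_ne_fun continuous_symMatrix.matrix_det continuous_const).measurableSet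

lemma measurable_trace_inv_symMatrix_mul {P : ℕ} (A : Matrix (Fin P) (Fin P) ℝ) :
    Measurable fun s : Sym2 (Fin P) → ℝ => ((symMatrix s)⁻¹ * A).trace := by
  simp only [trace, diag_apply, mul_apply]
  fun_prop

/-- The factor j = 0 is split off and the others shift by 1/2, which matches the shape a - 1/2 left
after the last row of Σ is integrated out. -/
lemma multiGamma_succ (P : ℕ) (a : ℝ) : multiGamma (P + 1) a =
    Real.pi ^ ((P : ℝ) / 2) * Real.Gamma a * multiGamma P (a - 1 / 2) := by
  have h1 : ((P + 1 : ℕ) : ℝ) * (((P + 1 : ℕ) : ℝ) - 1) / 4 =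
      (P : ℝ) / 2 + (P : ℝ) * ((P : ℝ) - 1) / 4 := by
    push_cast
    ring
  have h2 : ∀ j : Fin P, a - ((j.succ : Fin (P + 1)) : ℝ) / 2 = a - 1 / 2 - (j : ℝ) / 2 := by
    intro j
    simp only [Fin.val_succ]
    push_cast
    ring
  rw [multiGamma, multiGamma, h1, Real.rpow_add Real.pi_pos, Fin.prod_univ_succ]
  simp_rw [h2]
  simp only [Fin.val_zero, Nat.cast_zero, zero_div, sub_zero]
  ring

lemma multiGamma_pos {P : ℕ} {a : ℝ} (ha : (P : ℝ) - 1 < 2 * a) : 0 < multiGamma P a := by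
  refine mul_pos (Real.rpow_pos_of_pos Real.pi_pos _) (Finset.prod_pos fun j _ => ?_)
  apply Real.Gamma_pos_of_pos
  have h : (j : ℝ) + 1 ≤ P := by exact_mod_cast j.2
  linarith

/-- The unnormalized inverse Wishart density. -/
def invWishart {P : ℕ} (a : ℝ) (A : Matrix (Fin P) (Fin P) ℝ) (Sig : Matrix (Fin P) (Fin P) ℝ) :
    ℝ :=
  Sig.det ^ (-a - ((P : ℝ) + 1) / 2) * Real.exp (-(Sig⁻¹ * A).trace)

lemma measurable_invWishart {P : ℕ} (a : ℝ) (A : Matrix (Fin P) (Fin P) ℝ) :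
    Measurable fun s : Sym2 (Fin P) → ℝ => invWishart a A (symMatrix s) :=
  (measurable_det_symMatrix.pow_const _).mul
    (Real.measurable_exp.comp (measurable_trace_inv_symMatrix_mul A).neg)

lemma trace_submatrix_equiv {m n : Type*} [Fintype m] [Fintype n] (e : m ≃ n)
    (A : Matrix n n ℝ) : (A.submatrix e e).trace = A.trace :=
  e.sum_comp fun i => A i i

lemma symMatrix_blockCoords_eq_blockMatrix {P : ℕ} (s : Sym2 (Fin P) → ℝ) (u : Fin P → ℝ)
    (t : ℝ) : (symMatrix (blockCoords s (symMatrix s *ᵥ u)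
      (t + u ⬝ᵥ (symMatrix s *ᵥ u)))).submatrix finSumFinEquiv finSumFinEquiv =
        blockMatrix (symMatrix s) u t :=
  symMatrix_blockCoords _ _ _

lemma posDef_submatrix_equiv {m n : Type*} (e : m ≃ n) {A : Matrix n n ℝ} :
    (A.submatrix e e).PosDef ↔ A.PosDef := by
  refine ⟨fun h => ?_, fun h => h.submatrix e.injective⟩
  simpa using h.submatrix e.symm.injective

/-- In Schur complement coordinates the determinant is a product and the trace a sum, so the density
factors. Given t, the dependence on u is Gaussian with mean m and matrix t⁻¹A₁. -/
lemma indicator_invWishart_blockCoords {P : ℕ} (a : ℝ)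
    {A : Matrix (Fin (P + 1)) (Fin (P + 1)) ℝ} {A₁ : Matrix (Fin P) (Fin P) ℝ} {m : Fin P → ℝ}
    {δ : ℝ} (hA₁ : A₁.PosDef)
    (hA : A.submatrix finSumFinEquiv finSumFinEquiv = blockMatrix A₁ m δ)
    {s : Sym2 (Fin P) → ℝ} (hs : s ∈ posDefCone P) (u : Fin P → ℝ) (t : ℝ) :
    (posDefCone (P + 1)).indicator (fun x => ENNReal.ofReal (invWishart a A (symMatrix x)))
        (blockCoords s (symMatrix s *ᵥ u) (t + u ⬝ᵥ (symMatrix s *ᵥ u))) =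
      (Set.Ioi 0).indicator (fun t : ℝ =>
        ENNReal.ofReal ((symMatrix s).det ^ (-a - ((P : ℝ) + 2) / 2) *
          Real.exp (-((symMatrix s)⁻¹ * A₁).trace) * (t ^ (-a - ((P : ℝ) + 2) / 2) *
            Real.exp (-(δ / t)))) *
          ENNReal.ofReal (Real.exp (-((u - m) ⬝ᵥ ((t⁻¹ • A₁) *ᵥ (u - m)))))) t := by
  have hs' : (symMatrix s).PosDef := hs
  have hblk := symMatrix_blockCoords_eq_blockMatrix s u t
  set x := blockCoords s (symMatrix s *ᵥ u) (t + u ⬝ᵥ (symMatrix s *ᵥ u))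
  have hA₁T : A₁ᵀ = A₁ := by
    simpa [conjTranspose_eq_transpose_of_trivial] using hA₁.isHermitian.eq
  have hiff : x ∈ posDefCone (P + 1) ↔ 0 < t := by
    rw [posDefCone, Set.mem_ofPred_eq, ← posDef_submatrix_equiv finSumFinEquiv, hblk,
      posDef_blockMatrix_iff (symMatrix_transpose s)]
    simp [hs']
  by_cases ht : 0 < t
  · rw [Set.indicator_of_mem (hiff.mpr ht), Set.indicator_of_mem (Set.mem_Ioi.mpr ht),
      ← ENNReal.ofReal_mul (by have := hs'.det_pos; positivity)]
    congr 1
    have hdet : (symMatrix x).det = (symMatrix s).det * t := by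
      rw [← det_blockMatrix (symMatrix_transpose s) u t, ← hblk, det_submatrix_equiv_self]
    have htr : ((symMatrix x)⁻¹ * A).trace =
        ((symMatrix s)⁻¹ * A₁).trace + (δ + (u - m) ⬝ᵥ (A₁ *ᵥ (u - m))) / t := by
      rw [← trace_inv_blockMatrix_mul hs' hA₁T u m ht, ← hblk, ← hA, inv_submatrix_equiv,
        submatrix_mul_equiv, trace_submatrix_equiv]
    have hexp : -a - (((P + 1 : ℕ) : ℝ) + 1) / 2 = -a - ((P : ℝ) + 2) / 2 := by
      push_cast
      ring
    rw [invWishart, hdet, htr, hexp, Real.mul_rpow hs'.det_pos.le ht.le]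
    have hE : Real.exp (-(((symMatrix s)⁻¹ * A₁).trace +
        (δ + (u - m) ⬝ᵥ (A₁ *ᵥ (u - m))) / t)) =
        Real.exp (-((symMatrix s)⁻¹ * A₁).trace) * Real.exp (-(δ / t)) *
          Real.exp (-((u - m) ⬝ᵥ ((t⁻¹ • A₁) *ᵥ (u - m)))) := by
      rw [← Real.exp_add, ← Real.exp_add, smul_mulVec, dotProduct_smul, smul_eq_mul]
      congr 1
      field_simp
      ring
    rw [hE]
    ring
  · rw [Set.indicator_of_notMem (fun h => ht (hiff.mp h)),
      Set.indicator_of_notMem (show t ∉ Set.Ioi (0 : ℝ) from ht)]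

lemma measurable_dotProduct_mulVec_sub {ι : Type*} [Fintype ι] (A : Matrix ι ι ℝ) (m : ι → ℝ) :
    Measurable fun u : ι → ℝ => (u - m) ⬝ᵥ (A *ᵥ (u - m)) :=
  (Continuous.dotProduct (by fun_prop)
    (Continuous.matrix_mulVec (by fun_prop) (by fun_prop))).measurable

/-- Integrating the unnormalized inverse Wishart density over the last row and column. -/
lemma lintegral_invWishart_lastRow {P : ℕ} {a : ℝ} (ha : 0 < a)
    {A : Matrix (Fin (P + 1)) (Fin (P + 1)) ℝ} {A₁ : Matrix (Fin P) (Fin P) ℝ} {m : Fin P → ℝ}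
    {δ : ℝ} (hA₁ : A₁.PosDef) (hδ : 0 < δ)
    (hA : A.submatrix finSumFinEquiv finSumFinEquiv = blockMatrix A₁ m δ)
    {s : Sym2 (Fin P) → ℝ} (hs : s ∈ posDefCone P) :
    ∫⁻ v, ∫⁻ c, (posDefCone (P + 1)).indicator
        (fun x => ENNReal.ofReal (invWishart a A (symMatrix x))) (blockCoords s v c) =
      ENNReal.ofReal (invWishart (a - 1 / 2) A₁ (symMatrix s)) *
        ENNReal.ofReal (Real.pi ^ ((P : ℝ) / 2) * A₁.det ^ (-(1 : ℝ) / 2) *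
          (Real.Gamma a * δ ^ (-a))) := by
  have hs' : (symMatrix s).PosDef := hs
  have hdet := hs'.det_pos
  have hA₁d := hA₁.det_pos
  -- Off-diagonal column v = Σ₁u, with Jacobian |Σ₁|; then, for fixed u, the corner is translated by
  -- u'Σ₁u to become the Schur complement t.
  rw [lintegral_comp_mulVec hdet.ne']
  have hshift : ∀ u : Fin P → ℝ, ∫⁻ c, (posDefCone (P + 1)).indicator
      (fun x => ENNReal.ofReal (invWishart a A (symMatrix x)))
        (blockCoords s (symMatrix s *ᵥ u) c) = ∫⁻ t, (posDefCone (P + 1)).indicator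
      (fun x => ENNReal.ofReal (invWishart a A (symMatrix x)))
        (blockCoords s (symMatrix s *ᵥ u) (t + u ⬝ᵥ (symMatrix s *ᵥ u))) := fun u =>
    (lintegral_add_right_eq_self (fun c => (posDefCone (P + 1)).indicator
      (fun x => ENNReal.ofReal (invWishart a A (symMatrix x)))
        (blockCoords s (symMatrix s *ᵥ u) c)) _).symm
  simp_rw [hshift, indicator_invWishart_blockCoords a hA₁ hA hs]
  -- With t fixed, u is integrated first: the Gaussian contributes a factor t^(P/2), which leaves an
  -- inverse gamma integrand in t.
  rw [lintegral_lintegral_swap]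
  swap
  · apply Measurable.aemeasurable
    have hq := measurable_dotProduct_mulVec_sub A₁ m
    have : Measurable fun p : (Fin P → ℝ) × ℝ =>
        ENNReal.ofReal ((symMatrix s).det ^ (-a - ((P : ℝ) + 2) / 2) *
          Real.exp (-((symMatrix s)⁻¹ * A₁).trace) * (p.2 ^ (-a - ((P : ℝ) + 2) / 2) *
            Real.exp (-(δ / p.2)))) *
          ENNReal.ofReal (Real.exp (-((p.1 - m) ⬝ᵥ ((p.2⁻¹ • A₁) *ᵥ (p.1 - m))))) := by
      simp_rw [smul_mulVec, dotProduct_smul, smul_eq_mul]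
      have hq' : Measurable fun p : (Fin P → ℝ) × ℝ => (p.1 - m) ⬝ᵥ (A₁ *ᵥ (p.1 - m)) :=
        hq.comp measurable_fst
      fun_prop
    exact this.indicator (measurableSet_Ioi.preimage measurable_snd)
  have hinner : ∀ t : ℝ, (∫⁻ u : Fin P → ℝ, (Set.Ioi 0).indicator (fun t : ℝ =>
        ENNReal.ofReal ((symMatrix s).det ^ (-a - ((P : ℝ) + 2) / 2) *
          Real.exp (-((symMatrix s)⁻¹ * A₁).trace) * (t ^ (-a - ((P : ℝ) + 2) / 2) *
            Real.exp (-(δ / t)))) *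
          ENNReal.ofReal (Real.exp (-((u - m) ⬝ᵥ ((t⁻¹ • A₁) *ᵥ (u - m)))))) t) =
      (Set.Ioi 0).indicator (fun t : ℝ =>
        ENNReal.ofReal ((symMatrix s).det ^ (-a - ((P : ℝ) + 2) / 2) *
          Real.exp (-((symMatrix s)⁻¹ * A₁).trace) *
            (Real.pi ^ ((P : ℝ) / 2) * A₁.det ^ (-(1 : ℝ) / 2))) *
          ENNReal.ofReal (t ^ (-a - 1) * Real.exp (-(δ / t)))) t := by
    intro t
    by_cases ht : 0 < t
    · simp only [Set.indicator_of_mem (Set.mem_Ioi.mpr ht)]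
      rw [lintegral_const_mul' _ _ ENNReal.ofReal_ne_top,
        lintegral_exp_neg_quadratic (hA₁.smul (inv_pos.mpr ht)) m,
        ← ENNReal.ofReal_mul (by positivity), ← ENNReal.ofReal_mul (by positivity)]
      congr 1
      have h1 : (t⁻¹ • A₁).det ^ (-(1 : ℝ) / 2) = t ^ ((P : ℝ) / 2) * A₁.det ^ (-(1 : ℝ) / 2) := by
        rw [det_smul, Fintype.card_fin, Real.mul_rpow (by positivity) hA₁d.le, inv_pow,
          Real.inv_rpow (by positivity), ← Real.rpow_neg (by positivity), ← Real.rpow_natCast,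
          ← Real.rpow_mul ht.le]
        congr 2
        ring
      have h2 : t ^ (-a - 1) = t ^ (-a - ((P : ℝ) + 2) / 2) * t ^ ((P : ℝ) / 2) := by
        rw [← Real.rpow_add ht]
        congr 1
        ring
      rw [h1, h2, Fintype.card_fin]
      ring
    · simp [Set.indicator_of_notMem (show t ∉ Set.Ioi (0 : ℝ) from ht)]
  simp_rw [hinner]
  rw [lintegral_indicator measurableSet_Ioi, lintegral_const_mul' _ _ ENNReal.ofReal_ne_top,
    lintegral_rpow_mul_exp_neg_div ha hδ, abs_of_pos hdet]
  have hG := Real.Gamma_pos_of_pos ha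
  rw [← ENNReal.ofReal_mul (by positivity), ← ENNReal.ofReal_mul (by positivity),
    ← ENNReal.ofReal_mul (by rw [invWishart]; positivity)]
  congr 1
  -- The Jacobian |Σ₁| raises the exponent by one, which amounts to shape a - 1/2 in size P.
  have h3 : (symMatrix s).det ^ (-(a - 1 / 2) - ((P : ℝ) + 1) / 2) =
      (symMatrix s).det * (symMatrix s).det ^ (-a - ((P : ℝ) + 2) / 2) := by
    rw [← Real.rpow_one_add' hdet.le]
    · congr 1
      ring
    · have : (0 : ℝ) ≤ P := Nat.cast_nonneg P
      intro h
      linarith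
  rw [invWishart, h3]
  ring

/-- The normalizing constant of the inverse Wishart distribution. -/
theorem lintegral_invWishart (P : ℕ) {a : ℝ} (ha : (P : ℝ) - 1 < 2 * a)
    {A : Matrix (Fin P) (Fin P) ℝ} (hA : A.PosDef) :
    ∫⁻ s in posDefCone P, ENNReal.ofReal (invWishart a A (symMatrix s)) =
      ENNReal.ofReal (multiGamma P a * A.det ^ (-a)) := by
  induction P generalizing a with
  | zero =>
    -- For P = 0 there are no entries: the space is a single point of mass 1.
    have h : posDefCone 0 = Set.univ := by
      ext s
      simp only [posDefCone, Set.mem_ofPred_eq, Set.mem_univ, iff_true]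
      rw [Subsingleton.elim (symMatrix s) 1]
      exact PosDef.one
    rw [h, Measure.restrict_univ]
    simp [invWishart, multiGamma, Matrix.trace, volume_pi]
  | succ P ih =>
    have hP : (0 : ℝ) ≤ P := Nat.cast_nonneg P
    push_cast at ha
    have ha0 : 0 < a := by linarith
    obtain ⟨A₁, m, δ, hA₁, hδ, hblk⟩ := exists_eq_blockMatrix hA
    have hA₁T : A₁ᵀ = A₁ := by
      simpa [conjTranspose_eq_transpose_of_trivial] using hA₁.isHermitian.eq
    have hA₁d := hA₁.det_pos
    have hmeas : Measurable ((posDefCone (P + 1)).indicator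
        fun x => ENNReal.ofReal (invWishart a A (symMatrix x))) :=
      (measurable_invWishart a A).ennreal_ofReal.indicator (measurableSet_posDefCone _)
    rw [← lintegral_indicator (measurableSet_posDefCone _), lintegral_sym_succ hmeas]
    have hstep : ∀ s : Sym2 (Fin P) → ℝ, (∫⁻ v, ∫⁻ c, (posDefCone (P + 1)).indicator
        (fun x => ENNReal.ofReal (invWishart a A (symMatrix x))) (blockCoords s v c)) =
        (posDefCone P).indicator (fun s =>
          ENNReal.ofReal (invWishart (a - 1 / 2) A₁ (symMatrix s)) *
            ENNReal.ofReal (Real.pi ^ ((P : ℝ) / 2) * A₁.det ^ (-(1 : ℝ) / 2) *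
              (Real.Gamma a * δ ^ (-a)))) s := by
      intro s
      by_cases hs : s ∈ posDefCone P
      · rw [Set.indicator_of_mem hs, lintegral_invWishart_lastRow ha0 hA₁ hδ hblk hs]
      · rw [Set.indicator_of_notMem hs]
        -- A leading block of a positive definite matrix is positive definite, so both sides vanish
        -- off the smaller cone.
        have : ∀ v c, blockCoords s v c ∉ posDefCone (P + 1) := by
          intro v c h
          apply hs
          have h' : (symMatrix (blockCoords s v c)).PosDef := h
          rw [← posDef_submatrix_equiv finSumFinEquiv, symMatrix_blockCoords] at h'
          exact h'.submatrix (e := Sum.inl) Sum.inl_injective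
        simp [Set.indicator_of_notMem (this _ _)]
    simp_rw [hstep]
    rw [lintegral_indicator (measurableSet_posDefCone _),
      lintegral_mul_const' _ _ ENNReal.ofReal_ne_top, ih (by linarith) hA₁,
      ← ENNReal.ofReal_mul]
    swap
    · have := multiGamma_pos (P := P) (a := a - 1 / 2) (by linarith)
      positivity
    congr 1
    have hdet : A.det = A₁.det * δ := by
      rw [← det_blockMatrix hA₁T m δ, ← hblk, det_submatrix_equiv_self]
    have h1 : A₁.det ^ (-a) = A₁.det ^ (-(a - 1 / 2)) * A₁.det ^ (-(1 : ℝ) / 2) := by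
      rw [← Real.rpow_add hA₁d]
      congr 1
      ring
    rw [hdet, Real.mul_rpow hA₁d.le hδ.le, multiGamma_succ, h1]
    ring

/-! ### Least squares -/

variable {N K P qE qO d : ℕ}

lemma injective_mulVec_of_rank_eq {X : Matrix (Fin N) (Fin K) ℝ} (hX : X.rank = K) :
    Function.Injective X.mulVec := by
  have h : X.mulVecLin.ker = ⊥ := by
    have := X.mulVecLin.finrank_range_add_finrank_ker
    rw [← Matrix.rank, hX, Module.finrank_fin_fun] at this
    exact Submodule.finrank_eq_zero.mp (by omega)
  exact LinearMap.ker_eq_bot.mp h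

lemma posDef_transpose_mul_self {X : Matrix (Fin N) (Fin K) ℝ}
    (hX : Function.Injective X.mulVec) : (Xᵀ * X).PosDef := by
  simpa [conjTranspose_eq_transpose_of_trivial] using PosDef.conjTranspose_mul_self X hX

lemma fracRows_mulVec (b : Fin N → ℝ) (X : Matrix (Fin N) (Fin K) ℝ) (v : Fin K → ℝ) (i : Fin N) :
    (fracRows b X *ᵥ v) i = Real.sqrt (b i) * (X *ᵥ v) i := by
  simp [fracRows, mulVec, dotProduct, Finset.mul_sum, mul_assoc]

lemma fracRows_one (X : Matrix (Fin N) (Fin K) ℝ) : fracRows (fun _ => 1) X = X := by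
  ext i j
  simp [fracRows]

lemma injective_fracRows_mulVec {b : Fin N → ℝ} (hb : ∀ i, 0 < b i)
    {X : Matrix (Fin N) (Fin K) ℝ} (hX : Function.Injective X.mulVec) :
    Function.Injective (fracRows b X).mulVec := by
  intro v w h
  apply hX
  ext i
  have hi := congrFun h i
  change (fracRows b X *ᵥ v) i = (fracRows b X *ᵥ w) i at hi
  rw [fracRows_mulVec, fracRows_mulVec] at hi
  exact mul_left_cancel₀ (Real.sqrt_pos.mpr (hb i)).ne' hi

/-- The normal equations. -/
lemma transpose_mul_residual {X : Matrix (Fin N) (Fin K) ℝ} (hX : (Xᵀ * X).PosDef)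
    (Y : Matrix (Fin N) (Fin P) ℝ) : Xᵀ * (Y - X * lsEst Y X) = 0 := by
  rw [Matrix.mul_sub, lsEst, ← Matrix.mul_assoc, ← Matrix.mul_assoc, ← Matrix.mul_assoc,
    mul_nonsing_inv _ hX.det_pos.ne'.isUnit, Matrix.one_mul, sub_self]

/-- Pythagoras: the cross terms vanish by the normal equations. -/
lemma transpose_mul_self_eq_sumSq_add {X : Matrix (Fin N) (Fin K) ℝ} (hX : (Xᵀ * X).PosDef)
    (Y : Matrix (Fin N) (Fin P) ℝ) (Th : Matrix (Fin K) (Fin P) ℝ) :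
    (Y - X * Th)ᵀ * (Y - X * Th) =
      sumSq Y X + (Th - lsEst Y X)ᵀ * (Xᵀ * X) * (Th - lsEst Y X) := by
  have h1 := transpose_mul_residual hX Y
  have h2 : (Y - X * lsEst Y X)ᵀ * X = 0 := by
    have := congrArg transpose h1
    simpa [transpose_mul] using this
  have h3 : Y - X * Th = (Y - X * lsEst Y X) - X * (Th - lsEst Y X) := by
    rw [Matrix.mul_sub]
    abel
  rw [h3, sumSq]
  set R := Y - X * lsEst Y X
  set T := Th - lsEst Y X
  clear_value R T
  rw [transpose_sub, Matrix.sub_mul, Matrix.mul_sub, Matrix.mul_sub, ← Matrix.mul_assoc Rᵀ X T, h2,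
    transpose_mul, Matrix.mul_assoc Tᵀ Xᵀ R, h1]
  simp [Matrix.mul_assoc]

/-- The fractional residual sum of squares is positive definite when the full one is. -/
lemma posDef_sumSq_fracRows {b : Fin N → ℝ} (hb : ∀ i, 0 < b i)
    {X : Matrix (Fin N) (Fin K) ℝ} (hX : (Xᵀ * X).PosDef)
    {Y : Matrix (Fin N) (Fin P) ℝ} (hS : (sumSq Y X).PosDef) :
    (sumSq (fracRows b Y) (fracRows b X)).PosDef := by
  apply posDef_transpose_mul_self
  rw [← Matrix.coe_mulVecLin, ← LinearMap.ker_eq_bot, LinearMap.ker_eq_bot']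
  intro v hv
  rw [Matrix.coe_mulVecLin] at hv
  set C := lsEst (fracRows b Y) (fracRows b X)
  have h1 : (Y - X * C) *ᵥ v = 0 := by
    ext i
    have hi := congrFun hv i
    rw [sub_mulVec, ← mulVec_mulVec, Pi.sub_apply, fracRows_mulVec, fracRows_mulVec,
      ← mul_sub] at hi
    rw [sub_mulVec, ← mulVec_mulVec, Pi.sub_apply]
    exact (mul_eq_zero.mp hi).resolve_left (Real.sqrt_pos.mpr (hb i)).ne'
  -- Since every b_i is positive, v is also killed by the unweighted residual at C. Its cross
  -- product is S plus a semidefinite matrix, hence definite, and so v = 0.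
  have h2 : ((Y - X * C)ᵀ * (Y - X * C)) *ᵥ v = 0 := by
    rw [← mulVec_mulVec, h1, mulVec_zero]
  rw [transpose_mul_self_eq_sumSq_add hX] at h2
  have h3 : (sumSq Y X + (C - lsEst Y X)ᵀ * (Xᵀ * X) * (C - lsEst Y X)).PosDef := by
    refine hS.add_posSemidef ?_
    simpa [conjTranspose_eq_transpose_of_trivial] using
      hX.posSemidef.conjTranspose_mul_mul_same (C - lsEst Y X)
  by_contra hne
  have := h3.dotProduct_mulVec_pos hne
  rw [h2, dotProduct_zero] at this
  exact lt_irrefl _ this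

/-- If the residual sum of squares is positive definite then `K + P ≤ N`. -/
lemma add_le_of_posDef_sumSq {X : Matrix (Fin N) (Fin K) ℝ} (hX : (Xᵀ * X).PosDef)
    {Y : Matrix (Fin N) (Fin P) ℝ} (hS : (sumSq Y X).PosDef) : K + P ≤ N := by
  set R := Y - X * lsEst Y X with hR
  have hXR : Xᵀ * R = 0 := transpose_mul_residual hX Y
  -- The columns of X and of the residual R are independent within each block, and the two blocks
  -- are orthogonal, so K + P independent columns fit into ℝ^N.
  have hli : Function.Injective (fromCols X R).mulVec := by
    rw [← Matrix.coe_mulVecLin, ← LinearMap.ker_eq_bot, LinearMap.ker_eq_bot']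
    intro v hv
    rw [Matrix.coe_mulVecLin] at hv
    obtain ⟨y, z, rfl⟩ : ∃ y z, v = Sum.elim y z := ⟨v ∘ Sum.inl, v ∘ Sum.inr, by simp⟩
    rw [fromCols_mulVec_sumElim] at hv
    have h1 : (Xᵀ * X) *ᵥ y = 0 := by
      have := congrArg (Xᵀ *ᵥ ·) hv
      simpa [mulVec_add, mulVec_mulVec, hXR] using this
    have hy : y = 0 := by
      have := congrArg ((Xᵀ * X)⁻¹ *ᵥ ·) h1
      simpa [mulVec_mulVec, nonsing_inv_mul _ hX.det_pos.ne'.isUnit] using this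
    have h2 : (sumSq Y X) *ᵥ z = 0 := by
      rw [hy, mulVec_zero, zero_add] at hv
      rw [sumSq, ← hR, ← mulVec_mulVec, hv, mulVec_zero]
    have hz : z = 0 := by
      have := congrArg ((sumSq Y X)⁻¹ *ᵥ ·) h2
      simpa [mulVec_mulVec, nonsing_inv_mul _ hS.det_pos.ne'.isUnit] using this
    rw [hy, hz]
    ext (i | i) <;> simp
  have := LinearMap.finrank_le_finrank_of_injective (f := (fromCols X R).mulVecLin) hli
  simpa using this

/-! ### The likelihood as a function of the covariance matrix -/

/-- The row factors √b_i absorb the fractions, which is why the fractional likelihood depends on the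
data through Y_b and X_b. -/
lemma sum_mul_quadratic_eq_trace {b : Fin N → ℝ} (hb : ∀ i, 0 < b i)
    (Y : Matrix (Fin N) (Fin P) ℝ) (X : Matrix (Fin N) (Fin K) ℝ) (Th : Matrix (Fin K) (Fin P) ℝ)
    (W : Matrix (Fin P) (Fin P) ℝ) :
    ∑ i, b i * ((Y i - Thᵀ *ᵥ X i) ⬝ᵥ (W *ᵥ (Y i - Thᵀ *ᵥ X i))) =
      (W * ((fracRows b Y - fracRows b X * Th)ᵀ * (fracRows b Y - fracRows b X * Th))).trace := by
  set R := fracRows b Y - fracRows b X * Th with hR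
  have hrow : ∀ i, R i = Real.sqrt (b i) • (Y i - Thᵀ *ᵥ X i) := by
    intro i
    ext j
    simp [hR, fracRows, mul_apply, mulVec, dotProduct, Finset.mul_sum, mul_sub, mul_comm,
      mul_left_comm, mul_assoc]
  rw [← Matrix.mul_assoc, trace_mul_comm, trace]
  refine Finset.sum_congr rfl fun i _ => ?_
  have h1 : (R * (W * Rᵀ)).diag i = R i ⬝ᵥ (W *ᵥ R i) := by
    simp [diag_apply, mul_apply, mulVec, dotProduct]
  rw [h1, hrow, mulVec_smul, dotProduct_smul, smul_dotProduct, smul_eq_mul, smul_eq_mul,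
    ← mul_assoc, Real.mul_self_sqrt (hb i).le]

/-- The powers of |Σ| and the exponents add up over the observations. The Jeffreys exponent is
exactly the (P+1)/2 in the inverse Wishart density, so the shape is half the sum of the fractions.
-/
lemma fracLikelihood_mul_jeffreys {b : Fin N → ℝ} (hb : ∀ i, 0 < b i)
    (Y : Matrix (Fin N) (Fin P) ℝ) (X : Matrix (Fin N) (Fin K) ℝ) (Th : Matrix (Fin K) (Fin P) ℝ)
    {Sig : Matrix (Fin P) (Fin P) ℝ} (hSig : Sig.PosDef) :
    fracLikelihood b Y X Th Sig * jeffreys Sig = (2 * Real.pi) ^ (-((∑ i, b i) * P) / 2) *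
      invWishart ((∑ i, b i) / 2) ((1 / 2 : ℝ) •
        ((fracRows b Y - fracRows b X * Th)ᵀ * (fracRows b Y - fracRows b X * Th))) Sig := by
  have hd := hSig.det_pos
  have h2pi : 0 < 2 * Real.pi := by positivity
  have h1 : ∀ i, gaussDensity (Thᵀ *ᵥ X i) Sig (Y i) ^ b i =
      (2 * Real.pi) ^ (-(P : ℝ) / 2 * b i) * Sig.det ^ (-(1 : ℝ) / 2 * b i) *
        Real.exp (-(1 / 2) * (b i * ((Y i - Thᵀ *ᵥ X i) ⬝ᵥ (Sig⁻¹ *ᵥ (Y i - Thᵀ *ᵥ X i))))) := by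
    intro i
    rw [gaussDensity, Real.mul_rpow (by positivity) (by positivity),
      Real.mul_rpow (by positivity) (by positivity), ← Real.rpow_mul h2pi.le,
      ← Real.rpow_mul hd.le, ← Real.exp_mul]
    congr 2
    ring
  rw [fracLikelihood, jeffreys, invWishart, Finset.prod_congr rfl fun i _ => h1 i,
    Finset.prod_mul_distrib, Finset.prod_mul_distrib, ← Real.rpow_sum_of_pos h2pi,
    ← Real.rpow_sum_of_pos hd, ← Real.exp_sum, ← Finset.mul_sum, ← Finset.mul_sum,
    ← Finset.mul_sum, sum_mul_quadratic_eq_trace hb, Matrix.mul_smul, trace_smul, smul_eq_mul]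
  have h2 : Sig.det ^ (-(∑ i, b i) / 2 - ((P : ℝ) + 1) / 2) =
      Sig.det ^ (-(1 : ℝ) / 2 * ∑ i, b i) * Sig.det ^ (-((P : ℝ) + 1) / 2) := by
    rw [← Real.rpow_add hd]
    congr 1
    ring
  have h3 : -((∑ i, b i) / 2) - ((P : ℝ) + 1) / 2 = -(∑ i, b i) / 2 - ((P : ℝ) + 1) / 2 := by ring
  have h4 : -((∑ i, b i) * (P : ℝ)) / 2 = -(P : ℝ) / 2 * ∑ i, b i := by ring
  rw [h3, h2, h4, neg_mul]
  ring

lemma fracLikelihood_one (Y : Matrix (Fin N) (Fin P) ℝ) (X : Matrix (Fin N) (Fin K) ℝ) :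
    fracLikelihood (fun _ => 1) Y X = likelihood Y X := by
  ext Th Sig
  simp [fracLikelihood, likelihood]

/-- The residual sum of squares at `Th`, decomposed around the least squares estimate. -/
def quadSum (Y : Matrix (Fin N) (Fin P) ℝ) (X : Matrix (Fin N) (Fin K) ℝ)
    (Th : Matrix (Fin K) (Fin P) ℝ) : Matrix (Fin P) (Fin P) ℝ :=
  sumSq Y X + (Th - lsEst Y X)ᵀ * (Xᵀ * X) * (Th - lsEst Y X)

lemma posDef_quadSum {Y : Matrix (Fin N) (Fin P) ℝ} {X : Matrix (Fin N) (Fin K) ℝ}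
    (hX : (Xᵀ * X).PosDef) (hS : (sumSq Y X).PosDef) (Th : Matrix (Fin K) (Fin P) ℝ) :
    (quadSum Y X Th).PosDef := by
  refine hS.add_posSemidef ?_
  simpa [conjTranspose_eq_transpose_of_trivial] using
    hX.posSemidef.conjTranspose_mul_mul_same (Th - lsEst Y X)

lemma det_half_smul_rpow {A : Matrix (Fin P) (Fin P) ℝ} (hA : A.PosDef) (c : ℝ) :
    ((1 / 2 : ℝ) • A).det ^ (-c) = 2 ^ (P * c) * A.det ^ (-c) := by
  rw [det_smul, Fintype.card_fin, Real.mul_rpow (by positivity) hA.det_pos.le, one_div, inv_pow,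
    Real.inv_rpow (by positivity), ← Real.rpow_neg (by positivity), neg_neg, ← Real.rpow_natCast,
    ← Real.rpow_mul (by norm_num)]

/-- The posterior weight `∫ p(Y | X, Θ, Σ)ᵇ |Σ| ^ (-(P+1)/2) dΣ` of `Θ`. -/
lemma lintegral_fracLikelihood {b : Fin N → ℝ} (hb : ∀ i, 0 < b i)
    {Y : Matrix (Fin N) (Fin P) ℝ} {X : Matrix (Fin N) (Fin K) ℝ}
    (hX : ((fracRows b X)ᵀ * fracRows b X).PosDef)
    (hS : (sumSq (fracRows b Y) (fracRows b X)).PosDef) (hn : (P : ℝ) - 1 < ∑ i, b i)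
    (Th : Matrix (Fin K) (Fin P) ℝ) :
    ∫⁻ s in posDefCone P,
        ENNReal.ofReal (fracLikelihood b Y X Th (symMatrix s) * jeffreys (symMatrix s)) =
      ENNReal.ofReal (Real.pi ^ (-((∑ i, b i) * P) / 2) * multiGamma P ((∑ i, b i) / 2) *
        (quadSum (fracRows b Y) (fracRows b X) Th).det ^ (-((∑ i, b i) / 2))) := by
  have hq := posDef_quadSum hX hS Th
  have h1 : ∀ s ∈ posDefCone P,
      ENNReal.ofReal (fracLikelihood b Y X Th (symMatrix s) * jeffreys (symMatrix s)) =
        ENNReal.ofReal ((2 * Real.pi) ^ (-((∑ i, b i) * P) / 2)) *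
          ENNReal.ofReal (invWishart ((∑ i, b i) / 2) ((1 / 2 : ℝ) •
            quadSum (fracRows b Y) (fracRows b X) Th) (symMatrix s)) := by
    intro s hs
    rw [fracLikelihood_mul_jeffreys hb Y X Th hs, ENNReal.ofReal_mul (by positivity),
      transpose_mul_self_eq_sumSq_add hX, quadSum]
  rw [setLIntegral_congr_fun (measurableSet_posDefCone P) h1,
    lintegral_const_mul' _ _ ENNReal.ofReal_ne_top,
    lintegral_invWishart P (by linarith) (hq.smul (by norm_num)),
    ← ENNReal.ofReal_mul (by positivity), det_half_smul_rpow hq,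
    Real.mul_rpow (by norm_num) Real.pi_pos.le]
  congr 1
  have h2 : (2 : ℝ) ^ ((P : ℝ) * ((∑ i, b i) / 2)) = (2 ^ (-((∑ i, b i) * P) / 2))⁻¹ := by
    rw [← Real.rpow_neg (by norm_num)]
    congr 1
    ring
  rw [h2]
  have : (2 : ℝ) ^ (-((∑ i, b i) * P) / 2) ≠ 0 := by positivity
  field_simp

/-! ### The unconstrained evidence and the matrix `t` density -/

open scoped Kronecker in
lemma trace_inv_mul_eq_kronecker {W : Matrix (Fin P) (Fin P) ℝ} (hW : Wᵀ = W)
    (G : Matrix (Fin K) (Fin K) ℝ) (T : Matrix (Fin K) (Fin P) ℝ) :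
    (W * (Tᵀ * G * T)).trace = T.vec ⬝ᵥ ((W ⊗ₖ G) *ᵥ T.vec) := by
  rw [kronecker_mulVec_vec, vec_dotProduct_vec, hW, trace_mul_comm]
  simp only [Matrix.mul_assoc]

open scoped Kronecker in
/-- The matrix normal integral. -/
lemma lintegral_exp_neg_trace {Sig : Matrix (Fin P) (Fin P) ℝ} (hSig : Sig.PosDef)
    {G : Matrix (Fin K) (Fin K) ℝ} (hG : G.PosDef) (M : Matrix (Fin K) (Fin P) ℝ) :
    ∫⁻ v : Fin P × Fin K → ℝ, ENNReal.ofReal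
        (Real.exp (-(1 / 2 * (Sig⁻¹ * ((unvec v - M)ᵀ * G * (unvec v - M))).trace))) =
      ENNReal.ofReal ((2 * Real.pi) ^ ((P : ℝ) * K / 2) * G.det ^ (-(P : ℝ) / 2) *
        Sig.det ^ ((K : ℝ) / 2)) := by
  have hd := hSig.det_pos
  have hGd := hG.det_pos
  have hT : (Sig⁻¹)ᵀ = Sig⁻¹ := by
    simpa [conjTranspose_eq_transpose_of_trivial] using hSig.inv.isHermitian.eq
  have hvec : ∀ v : Fin P × Fin K → ℝ, (unvec v - M).vec = v - M.vec := fun v => rfl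
  have h1 : ∀ v : Fin P × Fin K → ℝ,
      1 / 2 * (Sig⁻¹ * ((unvec v - M)ᵀ * G * (unvec v - M))).trace =
        (v - M.vec) ⬝ᵥ (((1 / 2 : ℝ) • (Sig⁻¹ ⊗ₖ G)) *ᵥ (v - M.vec)) := by
    intro v
    rw [trace_inv_mul_eq_kronecker hT, hvec, smul_mulVec, dotProduct_smul, smul_eq_mul]
  simp_rw [h1]
  rw [lintegral_exp_neg_quadratic ((hSig.inv.kronecker hG).smul (by norm_num))]
  congr 1
  have h2 : ((1 / 2 : ℝ) • (Sig⁻¹ ⊗ₖ G)).det ^ (-(1 : ℝ) / 2) =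
      2 ^ ((P : ℝ) * K / 2) * (G.det ^ (-(P : ℝ) / 2) * Sig.det ^ ((K : ℝ) / 2)) := by
    rw [det_smul, det_kronecker, det_nonsing_inv, Ring.inverse_eq_inv', Fintype.card_prod,
      Fintype.card_fin, Fintype.card_fin, Real.mul_rpow (by positivity) (by positivity),
      Real.mul_rpow (by positivity) (by positivity), mul_comm ((Sig.det⁻¹ ^ K) ^ (-(1 : ℝ) / 2))]
    congr 1
    · rw [one_div, inv_pow, Real.inv_rpow (by positivity), ← Real.rpow_neg (by positivity),
        ← Real.rpow_natCast, ← Real.rpow_mul (by norm_num)]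
      congr 1
      push_cast
      ring
    · congr 1
      · rw [← Real.rpow_natCast, ← Real.rpow_mul hGd.le]
        congr 1
        ring
      · rw [inv_pow, Real.inv_rpow (by positivity), ← Real.rpow_neg (by positivity),
          ← Real.rpow_natCast, ← Real.rpow_mul hd.le]
        congr 1
        ring
  rw [h2, Real.mul_rpow (by norm_num) Real.pi_pos.le, Fintype.card_prod, Fintype.card_fin,
    Fintype.card_fin]
  push_cast
  ring

/-- In full dimension the normalized Hausdorff measure is Lebesgue measure. -/
lemma lintegral_euclideanHausdorffMeasure_univ (f : (Fin P × Fin K → ℝ) → ℝ≥0∞) :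
    ∫⁻ θ : EuclideanSpace ℝ (Fin P × Fin K), f θ.ofLp
      ∂(Measure.euclideanHausdorffMeasure (P * K)) = ∫⁻ v, f v := by
  have h : (Measure.euclideanHausdorffMeasure (P * K) :
      Measure (EuclideanSpace ℝ (Fin P × Fin K))) = volume := by
    rw [← InnerProductSpace.euclideanHausdorffMeasure_eq_volume]
    simp
  rw [h]
  exact (EuclideanSpace.volume_preserving_symm_measurableEquiv_toLp _).lintegral_comp_emb
    (MeasurableEquiv.measurableEmbedding _) f

/-- The evidence of the unconstrained model. -/
lemma evidence_univ {b : Fin N → ℝ} (hb : ∀ i, 0 < b i)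
    {Y : Matrix (Fin N) (Fin P) ℝ} {X : Matrix (Fin N) (Fin K) ℝ}
    (hX : ((fracRows b X)ᵀ * fracRows b X).PosDef)
    (hS : (sumSq (fracRows b Y) (fracRows b X)).PosDef)
    (hn : 0 < (∑ i, b i) - (K : ℝ) - (P : ℝ) + 1) :
    evidence (P * K) Set.univ (fracLikelihood b Y X) =
      ENNReal.ofReal (Real.pi ^ (-(((∑ i, b i) - K) * P) / 2) *
        ((fracRows b X)ᵀ * fracRows b X).det ^ (-(P : ℝ) / 2) *
        multiGamma P (((∑ i, b i) - K) / 2) *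
        (sumSq (fracRows b Y) (fracRows b X)).det ^ (-(((∑ i, b i) - K) / 2))) := by
  set n := ∑ i, b i
  set G := (fracRows b X)ᵀ * fracRows b X with hG
  set S := sumSq (fracRows b Y) (fracRows b X)
  have hGd := hX.det_pos
  have h2pi : 0 < 2 * Real.pi := by positivity
  -- For fixed Σ the Θ-integral is matrix normal and contributes |Σ|^(K/2), which lowers the inverse
  -- Wishart shape from n/2 to (n - K)/2.
  have h1 : ∀ s ∈ posDefCone P, (∫⁻ θ : EuclideanSpace ℝ (Fin P × Fin K) in Set.univ,
      ENNReal.ofReal (fracLikelihood b Y X (unvec θ.ofLp) (symMatrix s) * jeffreys (symMatrix s))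
        ∂(Measure.euclideanHausdorffMeasure (P * K))) =
      ENNReal.ofReal ((2 * Real.pi) ^ (-((n - K) * P) / 2) * G.det ^ (-(P : ℝ) / 2)) *
        ENNReal.ofReal (invWishart ((n - K) / 2) ((1 / 2 : ℝ) • S) (symMatrix s)) := by
    intro s hs
    have hs' : (symMatrix s).PosDef := hs
    have hd := hs'.det_pos
    have hW : 0 ≤ invWishart (n / 2) ((1 / 2 : ℝ) • S) (symMatrix s) := by
      rw [invWishart]
      positivity
    have h2 : ∀ v : Fin P × Fin K → ℝ, ENNReal.ofReal
        (fracLikelihood b Y X (unvec v) (symMatrix s) * jeffreys (symMatrix s)) =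
        ENNReal.ofReal ((2 * Real.pi) ^ (-(n * P) / 2) *
          invWishart (n / 2) ((1 / 2 : ℝ) • S) (symMatrix s)) *
        ENNReal.ofReal (Real.exp (-(1 / 2 * ((symMatrix s)⁻¹ *
          ((unvec v - lsEst (fracRows b Y) (fracRows b X))ᵀ * G *
            (unvec v - lsEst (fracRows b Y) (fracRows b X)))).trace))) := by
      intro v
      rw [fracLikelihood_mul_jeffreys hb Y X _ hs', ← ENNReal.ofReal_mul (by positivity),
        transpose_mul_self_eq_sumSq_add hX, invWishart, invWishart, Matrix.mul_smul,
        Matrix.mul_smul, Matrix.mul_add, trace_smul, trace_smul, trace_add, smul_add, neg_add,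
        Real.exp_add, smul_eq_mul, smul_eq_mul]
      congr 1
      ring
    rw [Measure.restrict_univ, lintegral_euclideanHausdorffMeasure_univ (fun v => ENNReal.ofReal
      (fracLikelihood b Y X (unvec v) (symMatrix s) * jeffreys (symMatrix s)))]
    simp_rw [h2]
    rw [lintegral_const_mul' _ _ ENNReal.ofReal_ne_top, lintegral_exp_neg_trace hs' hX,
      ← ENNReal.ofReal_mul (by positivity), ← ENNReal.ofReal_mul (by positivity)]
    congr 1
    have h3 : (2 * Real.pi) ^ (-((n - K) * P) / 2) =
        (2 * Real.pi) ^ (-(n * P) / 2) * (2 * Real.pi) ^ ((P : ℝ) * K / 2) := by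
      rw [← Real.rpow_add h2pi]
      congr 1
      ring
    have h4 : (symMatrix s).det ^ (-((n - K) / 2) - ((P : ℝ) + 1) / 2) =
        (symMatrix s).det ^ (-(n / 2) - ((P : ℝ) + 1) / 2) * (symMatrix s).det ^ ((K : ℝ) / 2) := by
      rw [← Real.rpow_add hd]
      congr 1
      ring
    rw [invWishart, invWishart, h3, h4]
    ring
  rw [evidence, setLIntegral_congr_fun (measurableSet_posDefCone P) h1,
    lintegral_const_mul' _ _ ENNReal.ofReal_ne_top,
    lintegral_invWishart P (by linarith) (hS.smul (by norm_num)),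
    ← ENNReal.ofReal_mul (by positivity), det_half_smul_rpow hS,
    Real.mul_rpow (by norm_num) Real.pi_pos.le]
  congr 1
  have h5 : (2 : ℝ) ^ ((P : ℝ) * ((n - K) / 2)) = (2 ^ (-((n - K) * P) / 2))⁻¹ := by
    rw [← Real.rpow_neg (by norm_num)]
    congr 1
    ring
  rw [h5]
  have : (2 : ℝ) ^ (-((n - K) * P) / 2) ≠ 0 := by positivity
  field_simp

lemma evidence_univ_mem_Ioo {b : Fin N → ℝ} (hb : ∀ i, 0 < b i)
    {Y : Matrix (Fin N) (Fin P) ℝ} {X : Matrix (Fin N) (Fin K) ℝ}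
    (hX : ((fracRows b X)ᵀ * fracRows b X).PosDef)
    (hS : (sumSq (fracRows b Y) (fracRows b X)).PosDef)
    (hn : 0 < (∑ i, b i) - (K : ℝ) - (P : ℝ) + 1) :
    evidence (P * K) Set.univ (fracLikelihood b Y X) ∈ Set.Ioo 0 ⊤ := by
  have hGd := hX.det_pos
  have hSd := hS.det_pos
  have hgam := multiGamma_pos (P := P) (a := ((∑ i, b i) - K) / 2) (by linarith)
  rw [evidence_univ hb hX hS hn]
  exact ⟨ENNReal.ofReal_pos.mpr (by positivity), ENNReal.ofReal_lt_top⟩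

lemma thetaDensity_eq_div (L : Matrix (Fin K) (Fin P) ℝ → Matrix (Fin P) (Fin P) ℝ → ℝ)
    (hL : evidence (P * K) Set.univ L ∈ Set.Ioo 0 ⊤) (Th : Matrix (Fin K) (Fin P) ℝ) :
    thetaDensity L Th = (∫⁻ s in posDefCone P,
      ENNReal.ofReal (L Th (symMatrix s) * jeffreys (symMatrix s))) /
        evidence (P * K) Set.univ L := by
  simp_rw [thetaDensity, div_eq_mul_inv]
  have hne := hL.1.ne'
  rw [lintegral_mul_const' _ _ (ENNReal.inv_ne_top.mpr hne)]

/-- The marginal density of `Θ` is a matrix `t` density. -/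
theorem thetaDensity_fracLikelihood {b : Fin N → ℝ} (hb : ∀ i, 0 < b i)
    {Y : Matrix (Fin N) (Fin P) ℝ} {X : Matrix (Fin N) (Fin K) ℝ}
    (hX : ((fracRows b X)ᵀ * fracRows b X).PosDef)
    (hS : (sumSq (fracRows b Y) (fracRows b X)).PosDef)
    (hn : 0 < (∑ i, b i) - (K : ℝ) - (P : ℝ) + 1) (Th : Matrix (Fin K) (Fin P) ℝ) :
    thetaDensity (fracLikelihood b Y X) Th = ENNReal.ofReal
      (matrixTDensity (lsEst (fracRows b Y) (fracRows b X)) ((fracRows b X)ᵀ * fracRows b X)⁻¹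
        (sumSq (fracRows b Y) (fracRows b X)) ((∑ i, b i) - (K : ℝ) - (P : ℝ) + 1) Th) := by
  have hGd := hX.det_pos
  have hSd := hS.det_pos
  have hQd := (posDef_quadSum hX hS Th).det_pos
  have hK : (0 : ℝ) ≤ K := Nat.cast_nonneg K
  have hgam := multiGamma_pos (P := P) (a := ((∑ i, b i) - K) / 2) (by linarith)
  -- Factoring S out of Q(Θ) produces the determinant in the matrix t density; the rest is
  -- bookkeeping of constants.
  have hdet : (quadSum (fracRows b Y) (fracRows b X) Th).det =
      (sumSq (fracRows b Y) (fracRows b X)).det *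
        (1 + (sumSq (fracRows b Y) (fracRows b X))⁻¹ * (Th - lsEst (fracRows b Y) (fracRows b X))ᵀ *
          ((fracRows b X)ᵀ * fracRows b X) * (Th - lsEst (fracRows b Y) (fracRows b X))).det := by
    rw [← det_mul, Matrix.mul_add, Matrix.mul_one, quadSum]
    simp only [Matrix.mul_assoc]
    rw [mul_nonsing_inv_cancel_left _ _ hSd.ne'.isUnit]
  rw [thetaDensity_eq_div _ (evidence_univ_mem_Ioo hb hX hS hn),
    lintegral_fracLikelihood hb hX hS (by linarith), evidence_univ hb hX hS hn,
    ← ENNReal.ofReal_div_of_pos (by positivity), matrixTDensity,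
    nonsing_inv_nonsing_inv _ hGd.ne'.isUnit, hdet]
  congr 1
  rw [hdet] at hQd
  have hDd := (mul_pos_iff_of_pos_left hSd).mp hQd
  set D := (1 + (sumSq (fracRows b Y) (fracRows b X))⁻¹ *
    (Th - lsEst (fracRows b Y) (fracRows b X))ᵀ * ((fracRows b X)ᵀ * fracRows b X) *
      (Th - lsEst (fracRows b Y) (fracRows b X))).det
  set S := (sumSq (fracRows b Y) (fracRows b X)).det
  set G := ((fracRows b X)ᵀ * fracRows b X).det with hG
  set n := ∑ i, b i
  have e1 : (n - (K : ℝ) - P + 1 + K + P - 1) / 2 = n / 2 := by ring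
  have e2 : (n - (K : ℝ) - P + 1 + P - 1) / 2 = (n - K) / 2 := by ring
  have e3 : -(n - (K : ℝ) - P + 1 + K + P - 1) / 2 = -(n / 2) := by ring
  have e4 : (((fracRows b X)ᵀ * fracRows b X)⁻¹).det ^ (-(P : ℝ) / 2) = (G ^ (-(P : ℝ) / 2))⁻¹ := by
    rw [det_nonsing_inv, Ring.inverse_eq_inv', ← hG, Real.inv_rpow hGd.le]
  have e5 : S ^ (-(n / 2)) = S ^ (-((n - K) / 2)) * S ^ (-(K : ℝ) / 2) := by
    rw [← Real.rpow_add hSd]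
    congr 1
    ring
  have e6 : Real.pi ^ (-((n - K) * P) / 2) =
      Real.pi ^ (-(n * P) / 2) * Real.pi ^ ((K : ℝ) * P / 2) := by
    rw [← Real.rpow_add Real.pi_pos]
    congr 1
    ring
  rw [e1, e2, e3, e4, Real.mul_rpow hSd.le hDd.le, e5, e6]
  have p1 : Real.pi ^ (-(n * P) / 2) ≠ 0 := by positivity
  have p2 : S ^ (-((n - K) / 2)) ≠ 0 := by positivity
  field_simp

/-! ### The coordinates `ζ = (R_E θ, D θ)` -/

section Coordinates

variable {RE : Matrix (Fin qE) (Fin P × Fin K) ℝ} {D : Matrix (Fin d) (Fin P × Fin K) ℝ}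
  {e : Fin qE ⊕ Fin d ≃ Fin P × Fin K}

lemma coordMatrix_mulVec (v : Fin P × Fin K → ℝ) :
    coordMatrix RE D e *ᵥ v = Sum.elim (RE *ᵥ v) (D *ᵥ v) ∘ e.symm := by
  ext i
  have : (coordMatrix RE D e *ᵥ v) i = (fromRows RE D *ᵥ v) (e.symm i) := rfl
  rw [this, fromRows_mulVec]
  rfl

lemma thetaOf_mulVec (hH : IsUnit (coordMatrix RE D e).det) (v : Fin P × Fin K → ℝ) :
    thetaOf RE D e (RE *ᵥ v) (D *ᵥ v) = v := by
  rw [thetaOf, ← coordMatrix_mulVec, mulVec_mulVec, nonsing_inv_mul _ hH, one_mulVec]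

lemma mulVec_thetaOf (hH : IsUnit (coordMatrix RE D e).det) (zE : Fin qE → ℝ) (zO : Fin d → ℝ) :
    RE *ᵥ thetaOf RE D e zE zO = zE ∧ D *ᵥ thetaOf RE D e zE zO = zO := by
  have h : coordMatrix RE D e *ᵥ thetaOf RE D e zE zO = Sum.elim zE zO ∘ e.symm := by
    rw [thetaOf, mulVec_mulVec, mul_nonsing_inv _ hH, one_mulVec]
  rw [coordMatrix_mulVec] at h
  have h' := e.symm.surjective.injective_comp_right h
  exact ⟨congrArg (· ∘ Sum.inl) h', congrArg (· ∘ Sum.inr) h'⟩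

lemma thetaOf_add (zE zE' : Fin qE → ℝ) (zO zO' : Fin d → ℝ) :
    thetaOf RE D e (zE + zE') (zO + zO') = thetaOf RE D e zE zO + thetaOf RE D e zE' zO' := by
  rw [thetaOf, thetaOf, thetaOf, ← mulVec_add]
  congr 1
  ext i
  simp only [Function.comp_apply, Pi.add_apply]
  rcases e.symm i with j | j <;> rfl

lemma thetaOf_smul (c : ℝ) (zE : Fin qE → ℝ) (zO : Fin d → ℝ) :
    thetaOf RE D e (c • zE) (c • zO) = c • thetaOf RE D e zE zO := by
  rw [thetaOf, thetaOf, ← mulVec_smul]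
  congr 1
  ext i
  simp only [Function.comp_apply, Pi.smul_apply]
  rcases e.symm i with j | j <;> rfl

lemma continuous_thetaOf :
    Continuous fun z : (Fin qE → ℝ) × (Fin d → ℝ) => thetaOf RE D e z.1 z.2 := by
  refine Continuous.matrix_mulVec continuous_const (continuous_pi fun i => ?_)
  simp only [Function.comp_apply]
  rcases e.symm i with j | j
  · exact (continuous_apply j).comp continuous_fst
  · exact (continuous_apply j).comp continuous_snd

lemma continuous_thetaOf_right (zE : Fin qE → ℝ) : Continuous (thetaOf RE D e zE) :=
  continuous_thetaOf.comp (by fun_prop : Continuous fun zO : Fin d → ℝ => (zE, zO))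

variable (RE D e) in
/-- The linear map `ζ_O ↦ H⁻¹ (0, ζ_O)` between Euclidean spaces. -/
def freeMap : EuclideanSpace ℝ (Fin d) →ₗ[ℝ] EuclideanSpace ℝ (Fin P × Fin K) where
  toFun z := WithLp.toLp 2 (thetaOf RE D e 0 z.ofLp)
  map_add' z w := by
    rw [WithLp.ofLp_add, ← add_zero (0 : Fin qE → ℝ), thetaOf_add, add_zero, WithLp.toLp_add]
  map_smul' c z := by
    have h := thetaOf_smul (RE := RE) (D := D) (e := e) c 0 z.ofLp
    rw [smul_zero] at h
    rw [WithLp.ofLp_smul, h, WithLp.toLp_smul]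
    rfl

lemma freeMap_injective (hH : IsUnit (coordMatrix RE D e).det) :
    Function.Injective (freeMap RE D e) := by
  intro z w h
  have h' : thetaOf RE D e 0 z.ofLp = thetaOf RE D e 0 w.ofLp := congrArg WithLp.ofLp h
  rw [← WithLp.toLp_ofLp (p := 2) z, ← WithLp.toLp_ofLp (p := 2) w,
    ← (mulVec_thetaOf hH 0 z.ofLp).2, ← (mulVec_thetaOf hH 0 w.ofLp).2, h']

lemma normDet_freeMap_pos (hH : IsUnit (coordMatrix RE D e).det) :
    0 < (freeMap RE D e).normDet :=
  lt_of_le_of_ne (LinearMap.normDet_nonneg _) (Ne.symm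
    (((freeMap RE D e).normDet_ne_zero_tfae.out 0 1).mpr
      (LinearMap.ker_eq_bot.mpr (freeMap_injective hH))))

/-- `d`-dimensional Lebesgue measure on a translate of the kernel of `R_E` is a multiple, not
depending on the translate, of Lebesgue measure in the coordinates `D θ`. -/
lemma setLIntegral_euclideanHausdorffMeasure (hH : IsUnit (coordMatrix RE D e).det)
    (c : Fin P × Fin K → ℝ) {M : Set (EuclideanSpace ℝ (Fin P × Fin K))} (hM : MeasurableSet M)
    (hMc : ∀ θ ∈ M, RE *ᵥ θ.ofLp = RE *ᵥ c)
    {f : EuclideanSpace ℝ (Fin P × Fin K) → ℝ≥0∞} (hf : Measurable f) :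
    ∫⁻ θ in M, f θ ∂(Measure.euclideanHausdorffMeasure d) =
      ENNReal.ofReal (freeMap RE D e).normDet *
        ∫⁻ zO in {zO | WithLp.toLp 2 (c + thetaOf RE D e 0 zO) ∈ M},
          f (WithLp.toLp 2 (c + thetaOf RE D e 0 zO)) := by
  set φ : (Fin d → ℝ) → EuclideanSpace ℝ (Fin P × Fin K) :=
    fun zO => WithLp.toLp 2 (c + thetaOf RE D e 0 zO) with hφ
  have hφm : Measurable φ :=
    ((PiLp.continuous_toLp 2 _).comp (continuous_const.add (continuous_thetaOf_right 0))).measurable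
  have hmeas : (Measure.euclideanHausdorffMeasure d).restrict M =
      ENNReal.ofReal (freeMap RE D e).normDet • (volume.map φ).restrict M := by
    ext A hA
    rw [Measure.restrict_apply hA, Measure.smul_apply, Measure.restrict_apply hA,
      Measure.map_apply hφm (hA.inter hM), smul_eq_mul]
    -- On the slice through c, the difference θ - c lies in the kernel of R_E and is recovered from
    -- its D-coordinates. The translation is an isometry, so only the linear map `freeMap` changes
    -- the measure, by a factor independent of c.
    have himg : A ∩ M = (fun x => WithLp.toLp 2 c + x) ''
        (freeMap RE D e '' (WithLp.ofLp ⁻¹' (φ ⁻¹' (A ∩ M)))) := by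
      ext θ
      constructor
      · intro hθ
        have hz : thetaOf RE D e 0 (D *ᵥ (θ.ofLp - c)) = θ.ofLp - c := by
          have h0 : RE *ᵥ (θ.ofLp - c) = 0 := by
            rw [mulVec_sub, hMc θ hθ.2, sub_self]
          rw [← h0, thetaOf_mulVec hH]
        refine ⟨WithLp.toLp 2 (θ.ofLp - c), ⟨WithLp.toLp 2 (D *ᵥ (θ.ofLp - c)), ?_, ?_⟩, ?_⟩
        · simp only [Set.mem_preimage, hφ, hz, add_sub_cancel]
          exact hθ
        · simp only [freeMap, LinearMap.coe_mk, AddHom.coe_mk, hz]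
        · simp only [← WithLp.toLp_add, add_sub_cancel]
      · rintro ⟨_, ⟨z, hz, rfl⟩, rfl⟩
        exact hz
    rw [himg, (isometry_add_left _).euclideanHausdorffMeasure_image]
    have h1 := (freeMap RE D e).euclideanHausdorffMeasure_image_eq_normDet_mul_volume
      (WithLp.ofLp ⁻¹' (φ ⁻¹' (A ∩ M)))
    rw [finrank_euclideanSpace, Fintype.card_fin] at h1
    rw [h1, (PiLp.volume_preserving_ofLp (Fin d)).measure_preimage
      (hφm (hA.inter hM)).nullMeasurableSet, ← himg]
  rw [hmeas, lintegral_smul_measure, smul_eq_mul, setLIntegral_map hM hf hφm]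
  rfl

/-- Integration in the coordinates `ζ`. -/
lemma lintegral_eq_lintegral_thetaOf (hH : IsUnit (coordMatrix RE D e).det)
    {f : (Fin P × Fin K → ℝ) → ℝ≥0∞} (hf : Measurable f) :
    ∫⁻ v, f v = ENNReal.ofReal |(coordMatrix RE D e)⁻¹.det| *
      ∫⁻ zE, ∫⁻ zO, f (thetaOf RE D e zE zO) := by
  have hdet : (coordMatrix RE D e)⁻¹.det ≠ 0 := by
    rw [det_nonsing_inv, Ring.inverse_eq_inv']
    exact inv_ne_zero hH.ne_zero
  have m1 := volume_measurePreserving_piCongrLeft (fun _ => ℝ) e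
  have m2 := volume_measurePreserving_sumPiEquivProdPi_symm (fun _ : Fin qE ⊕ Fin d => ℝ)
  have hg : Measurable fun w => f ((coordMatrix RE D e)⁻¹ *ᵥ w) :=
    hf.comp (Continuous.matrix_mulVec continuous_const continuous_id).measurable
  have key : ∀ zE zO, MeasurableEquiv.piCongrLeft (fun _ => ℝ) e
      ((MeasurableEquiv.sumPiEquivProdPi fun _ : Fin qE ⊕ Fin d => ℝ).symm (zE, zO)) =
      Sum.elim zE zO ∘ e.symm := by
    intro zE zO
    ext z
    obtain ⟨y, rfl⟩ := e.surjective z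
    rw [MeasurableEquiv.coe_piCongrLeft, Equiv.piCongrLeft_apply_apply,
      Function.comp_apply, Equiv.symm_apply_apply]
    rcases y with y | y <;> rfl
  rw [lintegral_comp_mulVec hdet, ← m1.lintegral_comp hg,
    ← m2.lintegral_comp (f := fun x => f ((coordMatrix RE D e)⁻¹ *ᵥ
      MeasurableEquiv.piCongrLeft (fun _ => ℝ) e x)) (hg.comp (MeasurableEquiv.measurable _)),
    Measure.volume_eq_prod, lintegral_prod _ (by fun_prop)]
  simp_rw [key]
  rfl

end Coordinates

/-! ### The weight of `Θ` after integrating out `Σ` -/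

/-- `∫ L(Θ, Σ) |Σ| ^ (-(P+1)/2) dΣ`. -/
def thetaWeight (L : Matrix (Fin K) (Fin P) ℝ → Matrix (Fin P) (Fin P) ℝ → ℝ)
    (Th : Matrix (Fin K) (Fin P) ℝ) : ℝ≥0∞ :=
  ∫⁻ s in posDefCone P, ENNReal.ofReal (L Th (symMatrix s) * jeffreys (symMatrix s))

lemma measurable_fracLikelihood_mul_jeffreys (b : Fin N → ℝ) (Y : Matrix (Fin N) (Fin P) ℝ)
    (X : Matrix (Fin N) (Fin K) ℝ) :
    Measurable fun p : (Sym2 (Fin P) → ℝ) × (Fin P × Fin K → ℝ) =>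
      fracLikelihood b Y X (unvec p.2) (symMatrix p.1) * jeffreys (symMatrix p.1) := by
  have hdet : Measurable fun p : (Sym2 (Fin P) → ℝ) × (Fin P × Fin K → ℝ) =>
      (symMatrix p.1).det := measurable_det_symMatrix.comp measurable_fst
  have hinv : ∀ i j, Measurable fun p : (Sym2 (Fin P) → ℝ) × (Fin P × Fin K → ℝ) =>
      (symMatrix p.1)⁻¹ i j := fun i j => (measurable_inv_symMatrix i j).comp measurable_fst
  have hres : ∀ i j, Measurable fun p : (Sym2 (Fin P) → ℝ) × (Fin P × Fin K → ℝ) =>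
      (Y i - (unvec p.2)ᵀ *ᵥ X i) j := by
    intro i j
    simp only [Pi.sub_apply, mulVec, dotProduct, transpose_apply, unvec, of_apply]
    fun_prop
  refine Measurable.mul (Finset.measurable_prod _ fun i _ => Measurable.pow_const ?_ _)
    (hdet.pow_const _)
  refine (measurable_const.mul (hdet.pow_const _)).mul (Real.measurable_exp.comp
    (measurable_const.mul ?_))
  simp only [dotProduct, mulVec]
  exact Finset.measurable_sum _ fun j _ => (hres i j).mul
    (Finset.measurable_sum _ fun k _ => (hinv j k).mul (hres i k))

lemma measurable_thetaWeight_unvec (b : Fin N → ℝ) (Y : Matrix (Fin N) (Fin P) ℝ)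
    (X : Matrix (Fin N) (Fin K) ℝ) :
    Measurable fun v => thetaWeight (fracLikelihood b Y X) (unvec v) :=
  Measurable.lintegral_prod_left'
    (measurable_fracLikelihood_mul_jeffreys b Y X).ennreal_ofReal

lemma unvec_add (v w : Fin P × Fin K → ℝ) : unvec (v + w) = unvec v + unvec w := rfl

lemma unvec_vec (M : Matrix (Fin K) (Fin P) ℝ) : unvec M.vec = M := rfl

lemma lintegral_thetaWeight (b : Fin N → ℝ) (Y : Matrix (Fin N) (Fin P) ℝ)
    (X : Matrix (Fin N) (Fin K) ℝ) :
    ∫⁻ v, thetaWeight (fracLikelihood b Y X) (unvec v) =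
      evidence (P * K) Set.univ (fracLikelihood b Y X) := by
  simp_rw [thetaWeight, evidence, Measure.restrict_univ]
  rw [lintegral_lintegral_swap]
  · refine lintegral_congr fun s => ?_
    rw [lintegral_euclideanHausdorffMeasure_univ (fun v => ENNReal.ofReal
      (fracLikelihood b Y X (unvec v) (symMatrix s) * jeffreys (symMatrix s)))]
  · exact ((measurable_fracLikelihood_mul_jeffreys b Y X).comp
      measurable_swap).ennreal_ofReal.aemeasurable

/-! ### Comparison of weights at different locations -/

/-- With A = C'C, cyclicity turns the trace into that of the semidefinite matrix C B C'. -/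
lemma trace_mul_nonneg {A B : Matrix (Fin P) (Fin P) ℝ} (hA : A.PosSemidef)
    (hB : B.PosSemidef) : 0 ≤ (A * B).trace := by
  obtain ⟨C, rfl⟩ := exists_transpose_mul_self hA
  rw [Matrix.mul_assoc, trace_mul_comm]
  have := (hB.mul_mul_conjTranspose_same C).trace_nonneg
  simpa [conjTranspose_eq_transpose_of_trivial] using this

/-- Negative powers of the determinant are antitone in the Loewner order. -/
lemma det_rpow_neg_anti {A B : Matrix (Fin P) (Fin P) ℝ} (hA : A.PosDef)
    (hAB : (B - A).PosSemidef) {a : ℝ} (ha : (P : ℝ) - 1 < 2 * a) :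
    B.det ^ (-a) ≤ A.det ^ (-a) := by
  have hB : B.PosDef := by
    have := hA.add_posSemidef hAB
    rwa [add_sub_cancel] at this
  have hAd := hA.det_pos
  have hg := multiGamma_pos ha
  -- No eigenvalues are needed: both powers are inverse Wishart integrals up to the same constant,
  -- and the integrands are ordered pointwise.
  have h : ∫⁻ s in posDefCone P, ENNReal.ofReal (invWishart a B (symMatrix s)) ≤
      ∫⁻ s in posDefCone P, ENNReal.ofReal (invWishart a A (symMatrix s)) := by
    refine setLIntegral_mono' (measurableSet_posDefCone P) fun s hs => ?_
    have hs' : (symMatrix s).PosDef := hs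
    have hd := hs'.det_pos
    apply ENNReal.ofReal_le_ofReal
    rw [invWishart, invWishart]
    refine mul_le_mul_of_nonneg_left (Real.exp_le_exp.mpr ?_) (by positivity)
    have := trace_mul_nonneg hs'.inv.posSemidef hAB
    rw [Matrix.mul_sub, trace_sub] at this
    linarith
  rw [lintegral_invWishart P ha hA, lintegral_invWishart P ha hB,
    ENNReal.ofReal_le_ofReal_iff (by positivity)] at h
  exact le_of_mul_le_mul_left h hg

lemma exists_dotProduct_mulVec_le {ι : Type*} [Fintype ι] (Q : Matrix ι ι ℝ) :
    ∃ q : ℝ, 0 ≤ q ∧ ∀ y : ι → ℝ, y ⬝ᵥ (Q *ᵥ y) ≤ q * (y ⬝ᵥ y) := by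
  refine ⟨∑ i, ∑ j, |Q i j|, by positivity, fun y => ?_⟩
  have hle : ∀ i, y i ^ 2 ≤ y ⬝ᵥ y := fun i => by
    rw [dotProduct, pow_two]
    exact Finset.single_le_sum (f := fun i => y i * y i) (fun j _ => mul_self_nonneg _)
      (Finset.mem_univ i)
  calc y ⬝ᵥ (Q *ᵥ y) = ∑ i, ∑ j, y i * (Q i j * y j) := by
        simp only [dotProduct, mulVec, Finset.mul_sum]
    _ ≤ ∑ i, ∑ j, |Q i j| * (y ⬝ᵥ y) := by
        refine Finset.sum_le_sum fun i _ => Finset.sum_le_sum fun j _ => ?_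
        have h1 := hle i
        have h2 := hle j
        rw [← sq_abs] at h1 h2
        calc y i * (Q i j * y j) ≤ |y i * (Q i j * y j)| := le_abs_self _
          _ = |Q i j| * (|y i| * |y j|) := by rw [abs_mul, abs_mul]; ring
          _ ≤ |Q i j| * (y ⬝ᵥ y) := by
            refine mul_le_mul_of_nonneg_left ?_ (abs_nonneg _)
            nlinarith [sq_nonneg (|y i| - |y j|)]
    _ = (∑ i, ∑ j, |Q i j|) * (y ⬝ᵥ y) := by simp_rw [Finset.sum_mul]

/-- A positive definite matrix dominates every symmetric matrix up to a factor. -/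
lemma exists_posSemidef_smul_sub {S Q : Matrix (Fin P) (Fin P) ℝ} (hS : S.PosDef)
    (hQ : Q.IsHermitian) : ∃ k : ℝ, 0 ≤ k ∧ (k • S - Q).PosSemidef := by
  obtain ⟨C, hC⟩ := exists_transpose_mul_self hS.posSemidef
  have hd := hS.det_pos
  rw [hC, det_mul, det_transpose] at hd
  have hCu : IsUnit C.det := IsUnit.mk0 _ fun h => by simp [h] at hd
  -- In the variable y = Cx the form S becomes the identity, so a bound for the transformed Q is
  -- enough.
  obtain ⟨k, hk, hle⟩ := exists_dotProduct_mulVec_le (C⁻¹ᵀ * Q * C⁻¹)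
  refine ⟨k, hk, .of_dotProduct_mulVec_nonneg ?_ fun x => ?_⟩
  · exact (hS.isHermitian.smul (by simp [IsSelfAdjoint])).sub hQ
  · have h := hle (C *ᵥ x)
    have e1 : (C *ᵥ x) ⬝ᵥ ((C⁻¹ᵀ * Q * C⁻¹) *ᵥ (C *ᵥ x)) = x ⬝ᵥ (Q *ᵥ x) := by
      rw [mulVec_mulVec, Matrix.mul_assoc, Matrix.mul_assoc, nonsing_inv_mul _ hCu, Matrix.mul_one,
        ← mulVec_mulVec, dotProduct_mulVec, vecMul_transpose, mulVec_mulVec, nonsing_inv_mul _ hCu,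
        one_mulVec]
    have e2 : (C *ᵥ x) ⬝ᵥ (C *ᵥ x) = x ⬝ᵥ (S *ᵥ x) := by
      rw [hC, ← mulVec_mulVec, dotProduct_mulVec x, vecMul_transpose]
    rw [e1, e2] at h
    rw [star_trivial, sub_mulVec, smul_mulVec, dotProduct_sub, dotProduct_smul, smul_eq_mul]
    linarith

/-- The residual sums of squares at `Th` and at a translate of it are comparable. -/
lemma exists_posSemidef_smul_quadSum_sub {Y : Matrix (Fin N) (Fin P) ℝ}
    {X : Matrix (Fin N) (Fin K) ℝ} (hX : (Xᵀ * X).PosDef) (hS : (sumSq Y X).PosDef)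
    (Δ : Matrix (Fin K) (Fin P) ℝ) : ∃ c : ℝ, 0 < c ∧ ∀ Th,
      (c • quadSum Y X Th - quadSum Y X (Th + Δ)).PosSemidef := by
  have hpsd : ∀ T : Matrix (Fin K) (Fin P) ℝ, (Tᵀ * (Xᵀ * X) * T).PosSemidef := fun T => by
    simpa [conjTranspose_eq_transpose_of_trivial] using hX.posSemidef.conjTranspose_mul_mul_same T
  obtain ⟨k, hk, hkS⟩ := exists_posSemidef_smul_sub hS
    ((hpsd Δ).smul (show (0 : ℝ) ≤ 2 by norm_num)).isHermitian
  -- With T = Θ - Θ̂ and G = X'X, the parallelogram law bounds (T+Δ)'G(T+Δ) by 2T'GT + 2Δ'GΔ. The 2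
  -- pays for the first term, and kS for the second.
  refine ⟨k + 2, by linarith, fun Th => ?_⟩
  have h : (k + 2) • quadSum Y X Th - quadSum Y X (Th + Δ) =
      (k • sumSq Y X - (2 : ℝ) • (Δᵀ * (Xᵀ * X) * Δ)) + sumSq Y X +
        k • ((Th - lsEst Y X)ᵀ * (Xᵀ * X) * (Th - lsEst Y X)) +
        (Th - lsEst Y X - Δ)ᵀ * (Xᵀ * X) * (Th - lsEst Y X - Δ) := by
    have e : Th + Δ - lsEst Y X = (Th - lsEst Y X) + Δ := by abel
    rw [quadSum, quadSum, e]
    generalize Th - lsEst Y X = T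
    generalize Xᵀ * X = G
    simp only [transpose_add, transpose_sub, Matrix.add_mul, Matrix.mul_add, Matrix.sub_mul,
      Matrix.mul_sub]
    module
  rw [h]
  exact ((hkS.add hS.posSemidef).add ((hpsd _).smul hk)).add (hpsd _)

section Weight

variable {b : Fin N → ℝ} {Y : Matrix (Fin N) (Fin P) ℝ} {X : Matrix (Fin N) (Fin K) ℝ}

lemma thetaWeight_pos (hb : ∀ i, 0 < b i) (hX : ((fracRows b X)ᵀ * fracRows b X).PosDef)
    (hS : (sumSq (fracRows b Y) (fracRows b X)).PosDef) (hn : (P : ℝ) - 1 < ∑ i, b i)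
    (Th : Matrix (Fin K) (Fin P) ℝ) : 0 < thetaWeight (fracLikelihood b Y X) Th := by
  have hQd := (posDef_quadSum hX hS Th).det_pos
  have hg := multiGamma_pos (P := P) (a := (∑ i, b i) / 2) (by linarith)
  rw [thetaWeight, lintegral_fracLikelihood hb hX hS hn]
  exact ENNReal.ofReal_pos.mpr (by positivity)

/-- A Harnack-type bound, uniform in Θ for fixed Δ: from Q(Θ+Δ) ≤ c Q(Θ) and antitonicity of
negative determinant powers, with constant c^(Pn/2). -/
lemma exists_thetaWeight_le (hb : ∀ i, 0 < b i) (hX : ((fracRows b X)ᵀ * fracRows b X).PosDef)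
    (hS : (sumSq (fracRows b Y) (fracRows b X)).PosDef) (hn : (P : ℝ) - 1 < ∑ i, b i)
    (Δ : Matrix (Fin K) (Fin P) ℝ) : ∃ C : ℝ, ∀ Th,
      thetaWeight (fracLikelihood b Y X) Th ≤
        ENNReal.ofReal C * thetaWeight (fracLikelihood b Y X) (Th + Δ) := by
  obtain ⟨c, hc, hle⟩ := exists_posSemidef_smul_quadSum_sub hX hS Δ
  refine ⟨(c ^ P) ^ ((∑ i, b i) / 2), fun Th => ?_⟩
  have hQ := posDef_quadSum hX hS Th
  have hQd := hQ.det_pos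
  have hg := multiGamma_pos (P := P) (a := (∑ i, b i) / 2) (by linarith)
  have h := det_rpow_neg_anti (posDef_quadSum hX hS (Th + Δ)) (hle Th)
    (a := (∑ i, b i) / 2) (by linarith)
  rw [det_smul, Fintype.card_fin, Real.mul_rpow (by positivity) hQd.le,
    Real.rpow_neg (by positivity)] at h
  rw [thetaWeight, thetaWeight, lintegral_fracLikelihood hb hX hS hn,
    lintegral_fracLikelihood hb hX hS hn, ← ENNReal.ofReal_mul (by positivity)]
  apply ENNReal.ofReal_le_ofReal
  have hcp : 0 < (c ^ P) ^ ((∑ i, b i) / 2) := by positivity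
  rw [inv_mul_le_iff₀ hcp] at h
  calc _ ≤ Real.pi ^ (-((∑ i, b i) * P) / 2) * multiGamma P ((∑ i, b i) / 2) *
        ((c ^ P) ^ ((∑ i, b i) / 2) *
          (quadSum (fracRows b Y) (fracRows b X) (Th + Δ)).det ^ (-((∑ i, b i) / 2))) :=
        mul_le_mul_of_nonneg_left h (by positivity)
    _ = _ := by ring

variable {RE : Matrix (Fin qE) (Fin P × Fin K) ℝ} {D : Matrix (Fin d) (Fin P × Fin K) ℝ}
  {e : Fin qE ⊕ Fin d ≃ Fin P × Fin K}

lemma measurable_thetaWeight_thetaOf (b : Fin N → ℝ) (Y : Matrix (Fin N) (Fin P) ℝ)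
    (X : Matrix (Fin N) (Fin K) ℝ) (zE : Fin qE → ℝ) (E : Matrix (Fin K) (Fin P) ℝ) :
    Measurable fun zO =>
      thetaWeight (fracLikelihood b Y X) (unvec (thetaOf RE D e zE zO) + E) := by
  have h : Measurable fun zO => thetaOf RE D e zE zO + E.vec :=
    (continuous_thetaOf_right zE).measurable.add_const E.vec
  simpa only [Function.comp_def, unvec_add, unvec_vec] using
    (measurable_thetaWeight_unvec b Y X).comp h

/-- The weight is integrable over every translate of the kernel of `R_E`. -/
lemma lintegral_thetaWeight_thetaOf_lt_top (hb : ∀ i, 0 < b i)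
    (hX : ((fracRows b X)ᵀ * fracRows b X).PosDef)
    (hS : (sumSq (fracRows b Y) (fracRows b X)).PosDef)
    (hn : 0 < (∑ i, b i) - (K : ℝ) - (P : ℝ) + 1)
    (hH : IsUnit (coordMatrix RE D e).det) (zE : Fin qE → ℝ) (E : Matrix (Fin K) (Fin P) ℝ) :
    ∫⁻ zO, thetaWeight (fracLikelihood b Y X) (unvec (thetaOf RE D e zE zO) + E) < ⊤ := by
  have hK : (0 : ℝ) ≤ K := Nat.cast_nonneg K
  have hm := measurable_thetaWeight_unvec b Y X
  have hfin := (evidence_univ_mem_Ioo hb hX hS hn).2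
  rw [← lintegral_thetaWeight, lintegral_eq_lintegral_thetaOf hH hm] at hfin
  have hdet : ENNReal.ofReal |(coordMatrix RE D e)⁻¹.det| ≠ 0 := by
    rw [det_nonsing_inv, Ring.inverse_eq_inv']
    exact (ENNReal.ofReal_pos.mpr (abs_pos.mpr (inv_ne_zero hH.ne_zero))).ne'
  have hfin' := (ENNReal.lt_top_of_mul_ne_top_right hfin.ne hdet).ne
  -- By Tonelli some slice has a finite integral. The given slice is a translate of it, so the
  -- comparison bound applies.
  have hae := ae_lt_top (Measurable.lintegral_prod_right'
    (f := fun z : (Fin qE → ℝ) × (Fin d → ℝ) =>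
      thetaWeight (fracLikelihood b Y X) (unvec (thetaOf RE D e z.1 z.2)))
    (hm.comp continuous_thetaOf.measurable)) hfin'
  obtain ⟨zE', hzE'⟩ := hae.exists
  obtain ⟨C, hC⟩ := exists_thetaWeight_le hb hX hS (by linarith)
    (unvec (thetaOf RE D e (zE' - zE) 0) - E)
  have hshift : ∀ zO, unvec (thetaOf RE D e zE zO) + E +
      (unvec (thetaOf RE D e (zE' - zE) 0) - E) = unvec (thetaOf RE D e zE' zO) := by
    intro zO
    have h := thetaOf_add (RE := RE) (D := D) (e := e) zE (zE' - zE) zO 0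
    rw [add_sub_cancel, add_zero] at h
    rw [h, unvec_add]
    abel
  calc ∫⁻ zO, thetaWeight (fracLikelihood b Y X) (unvec (thetaOf RE D e zE zO) + E)
      ≤ ∫⁻ zO, ENNReal.ofReal C *
          thetaWeight (fracLikelihood b Y X) (unvec (thetaOf RE D e zE' zO)) := by
        refine lintegral_mono fun zO => ?_
        have := hC (unvec (thetaOf RE D e zE zO) + E)
        rwa [hshift] at this
    _ < ⊤ := by
        rw [lintegral_const_mul' _ _ ENNReal.ofReal_ne_top]
        exact ENNReal.mul_lt_top ENNReal.ofReal_lt_top hzE'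

end Weight

/-! ### The constrained evidence -/

section Constrained

variable {b : Fin N → ℝ} {Y : Matrix (Fin N) (Fin P) ℝ} {X : Matrix (Fin N) (Fin K) ℝ}
  {RE : Matrix (Fin qE) (Fin P × Fin K) ℝ} {rE : Fin qE → ℝ}
  {RO : Matrix (Fin qO) (Fin P × Fin K) ℝ} {rO : Fin qO → ℝ}
  {D : Matrix (Fin d) (Fin P × Fin K) ℝ} {e : Fin qE ⊕ Fin d ≃ Fin P × Fin K}

variable (RE rE RO rO D e) in
/-- The order constraints in the coordinates `D θ`. -/
def orderRegion : Set (Fin d → ℝ) :=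
  {zO | ∀ i, rO i < (RO *ᵥ thetaOf RE D e rE zO) i}

lemma isOpen_orderRegion : IsOpen (orderRegion RE rE RO rO D e) := by
  have h : orderRegion RE rE RO rO D e = ⋂ i, {zO | rO i < (RO *ᵥ thetaOf RE D e rE zO) i} := by
    ext zO
    simp [orderRegion]
  rw [h]
  refine isOpen_iInter_of_finite fun i => isOpen_lt continuous_const ?_
  exact (continuous_apply i).comp
    (Continuous.matrix_mulVec continuous_const (continuous_thetaOf_right rE))

lemma orderRegion_nonempty (hH : IsUnit (coordMatrix RE D e).det)
    (hM : (constrSet RE rE RO rO).Nonempty) : (orderRegion RE rE RO rO D e).Nonempty := by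
  obtain ⟨θ, h1, h2⟩ := hM
  refine ⟨D *ᵥ θ.ofLp, ?_⟩
  rw [← h1]
  simpa only [orderRegion, Set.mem_ofPred_eq, thetaOf_mulVec hH] using h2

/-- The evidence of a translate by `E` of the constrained space, in the coordinates `D θ`. -/
lemma evidence_translate (hH : IsUnit (coordMatrix RE D e).det)
    {M : Set (EuclideanSpace ℝ (Fin P × Fin K))} (E : Matrix (Fin K) (Fin P) ℝ)
    (hM : ∀ θ, θ ∈ M ↔ RE *ᵥ (θ.ofLp - E.vec) = rE ∧ ∀ i, rO i < (RO *ᵥ (θ.ofLp - E.vec)) i) :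
    evidence (P * K - qE) M (fracLikelihood b Y X) =
      ENNReal.ofReal (freeMap RE D e).normDet * ∫⁻ zO in orderRegion RE rE RO rO D e,
        thetaWeight (fracLikelihood b Y X) (unvec (thetaOf RE D e rE zO) + E) := by
  have hd : P * K - qE = d := by
    have := Fintype.card_congr e
    simp only [Fintype.card_sum, Fintype.card_fin, Fintype.card_prod] at this
    omega
  have hL := (measurable_fracLikelihood_mul_jeffreys b Y X).ennreal_ofReal
  -- Base point of the translated slice, chosen so that its D-coordinates match those of the
  -- untranslated region.
  set c := thetaOf RE D e rE 0 + E.vec with hc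
  have hθ : ∀ zO, c + thetaOf RE D e 0 zO = thetaOf RE D e rE zO + E.vec := by
    intro zO
    have h := thetaOf_add (RE := RE) (D := D) (e := e) rE 0 0 zO
    rw [add_zero, zero_add] at h
    rw [h, hc]
    abel
  have hMm : MeasurableSet M := by
    have hsub : Continuous fun θ : EuclideanSpace ℝ (Fin P × Fin K) => θ.ofLp - E.vec :=
      (PiLp.continuous_ofLp 2 _).sub continuous_const
    have h : M = {θ | RE *ᵥ (θ.ofLp - E.vec) = rE} ∩
        ⋂ i, {θ | rO i < (RO *ᵥ (θ.ofLp - E.vec)) i} := by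
      ext θ
      simp [hM]
    rw [h]
    refine (isClosed_eq (Continuous.matrix_mulVec continuous_const hsub)
      continuous_const).measurableSet.inter (MeasurableSet.iInter fun i => ?_)
    exact (isOpen_lt continuous_const ((continuous_apply i).comp
      (Continuous.matrix_mulVec continuous_const hsub))).measurableSet
  have hMc : ∀ θ ∈ M, RE *ᵥ θ.ofLp = RE *ᵥ c := by
    intro θ h
    have h1 := ((hM θ).mp h).1
    rw [mulVec_sub, sub_eq_iff_eq_add] at h1
    rw [hc, mulVec_add, (mulVec_thetaOf hH rE 0).1, h1]
  have hreg : {zO | WithLp.toLp 2 (c + thetaOf RE D e 0 zO) ∈ M} =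
      orderRegion RE rE RO rO D e := by
    ext zO
    simp [hM, hθ, orderRegion, (mulVec_thetaOf hH rE zO).1]
  have hinner : ∀ s : Sym2 (Fin P) → ℝ, (∫⁻ θ in M, ENNReal.ofReal
      (fracLikelihood b Y X (unvec θ.ofLp) (symMatrix s) * jeffreys (symMatrix s))
        ∂(Measure.euclideanHausdorffMeasure d)) =
      ENNReal.ofReal (freeMap RE D e).normDet * ∫⁻ zO in orderRegion RE rE RO rO D e,
        ENNReal.ofReal (fracLikelihood b Y X (unvec (thetaOf RE D e rE zO) + E) (symMatrix s) *
          jeffreys (symMatrix s)) := by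
    intro s
    have hf : Measurable fun θ : EuclideanSpace ℝ (Fin P × Fin K) => ENNReal.ofReal
        (fracLikelihood b Y X (unvec θ.ofLp) (symMatrix s) * jeffreys (symMatrix s)) := by
      have h1 : Measurable fun θ : EuclideanSpace ℝ (Fin P × Fin K) => (s, θ.ofLp) :=
        measurable_const.prodMk (PiLp.continuous_ofLp 2 _).measurable
      simpa only [Function.comp_def] using hL.comp h1
    rw [setLIntegral_euclideanHausdorffMeasure hH c hMm hMc hf, hreg]
    simp_rw [hθ, unvec_add, unvec_vec]
  rw [evidence, hd]
  simp_rw [hinner]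
  rw [lintegral_const_mul' _ _ ENNReal.ofReal_ne_top, lintegral_lintegral_swap]
  · rfl
  · have h1 : Measurable fun p : (Sym2 (Fin P) → ℝ) × (Fin d → ℝ) =>
        (p.1, thetaOf RE D e rE p.2 + E.vec) :=
      measurable_fst.prodMk
        (((continuous_thetaOf_right rE).measurable.comp measurable_snd).add_const E.vec)
    have h2 := hL.comp h1
    simp only [Function.comp_def, unvec_add, unvec_vec] at h2
    exact h2.aemeasurable

/-- The integral of the weight over the constrained region is positive and finite. -/
lemma setLIntegral_thetaWeight_mem_Ioo (hb : ∀ i, 0 < b i)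
    (hX : ((fracRows b X)ᵀ * fracRows b X).PosDef)
    (hS : (sumSq (fracRows b Y) (fracRows b X)).PosDef)
    (hn : 0 < (∑ i, b i) - (K : ℝ) - (P : ℝ) + 1)
    (hH : IsUnit (coordMatrix RE D e).det) (E : Matrix (Fin K) (Fin P) ℝ)
    {T : Set (Fin d → ℝ)} (hT : IsOpen T) (hT' : T.Nonempty) :
    ∫⁻ zO in T, thetaWeight (fracLikelihood b Y X) (unvec (thetaOf RE D e rE zO) + E) ∈
      Set.Ioo 0 ⊤ := by
  have hK : (0 : ℝ) ≤ K := Nat.cast_nonneg K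
  refine ⟨?_, (setLIntegral_le_lintegral _ _).trans_lt
    (lintegral_thetaWeight_thetaOf_lt_top hb hX hS hn hH rE E)⟩
  -- The weight is positive everywhere and a nonempty open set has positive volume.
  rw [setLIntegral_pos_iff (measurable_thetaWeight_thetaOf b Y X rE E)]
  have hsupp : (Function.support fun zO =>
      thetaWeight (fracLikelihood b Y X) (unvec (thetaOf RE D e rE zO) + E)) = Set.univ :=
    Set.eq_univ_of_forall fun zO => (thetaWeight_pos hb hX hS (by linarith) _).ne'
  rw [hsupp, Set.univ_inter]
  exact hT.measure_pos volume hT'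

end Constrained

/-! ### Marginal density and conditional probability -/

section Conditional

variable {RE : Matrix (Fin qE) (Fin P × Fin K) ℝ} {rE : Fin qE → ℝ}
  {RO : Matrix (Fin qO) (Fin P × Fin K) ℝ} {rO : Fin qO → ℝ}
  {D : Matrix (Fin d) (Fin P × Fin K) ℝ} {e : Fin qE ⊕ Fin d ≃ Fin P × Fin K}

lemma margDensity_eq {π w : Matrix (Fin K) (Fin P) ℝ → ℝ≥0∞} {Z : ℝ≥0∞} (hZ : Z ∈ Set.Ioo 0 ⊤)
    (hπ : ∀ Th, π Th = w Th / Z) : margDensity RE D e π rE =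
      ENNReal.ofReal (|(coordMatrix RE D e).det|⁻¹) *
        (∫⁻ zO, w (unvec (thetaOf RE D e rE zO))) / Z := by
  simp_rw [margDensity, zetaDensity, hπ, div_eq_mul_inv]
  rw [lintegral_const_mul' _ _ ENNReal.ofReal_ne_top,
    lintegral_mul_const' _ _ (ENNReal.inv_ne_top.mpr hZ.1.ne'), mul_assoc]

lemma condProb_eq {π w : Matrix (Fin K) (Fin P) ℝ → ℝ≥0∞} {Z : ℝ≥0∞} (hZ : Z ∈ Set.Ioo 0 ⊤)
    (hπ : ∀ Th, π Th = w Th / Z) (hmarg : margDensity RE D e π rE ≠ 0) :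
    condProb RE D e RO rO π rE = ENNReal.ofReal (|(coordMatrix RE D e).det|⁻¹) *
      (∫⁻ zO in orderRegion RE rE RO rO D e, w (unvec (thetaOf RE D e rE zO))) / Z /
        margDensity RE D e π rE := by
  simp_rw [condProb, zetaDensity, hπ, div_eq_mul_inv]
  rw [lintegral_mul_const' _ _ (ENNReal.inv_ne_top.mpr hmarg),
    lintegral_const_mul' _ _ ENNReal.ofReal_ne_top,
    lintegral_mul_const' _ _ (ENNReal.inv_ne_top.mpr hZ.1.ne'), ← mul_assoc]
  rfl

/-- Marginal density, conditional probability and their product, for a density `π` that is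
proportional to `w`. -/
lemma margDensity_condProb {π w : Matrix (Fin K) (Fin P) ℝ → ℝ≥0∞} {Z : ℝ≥0∞}
    (hH : IsUnit (coordMatrix RE D e).det) (hZ : Z ∈ Set.Ioo 0 ⊤)
    (hπ : ∀ Th, π Th = w Th / Z)
    (hall : ∫⁻ zO, w (unvec (thetaOf RE D e rE zO)) ∈ Set.Ioo 0 ⊤)
    (hreg : ∫⁻ zO in orderRegion RE rE RO rO D e, w (unvec (thetaOf RE D e rE zO)) ∈
      Set.Ioo 0 ⊤) :
    margDensity RE D e π rE ∈ Set.Ioo 0 ⊤ ∧ condProb RE D e RO rO π rE ∈ Set.Ioc 0 1 ∧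
      margDensity RE D e π rE * condProb RE D e RO rO π rE =
        ENNReal.ofReal (|(coordMatrix RE D e).det|⁻¹) *
          (∫⁻ zO in orderRegion RE rE RO rO D e, w (unvec (thetaOf RE D e rE zO))) / Z := by
  have hJ : ENNReal.ofReal (|(coordMatrix RE D e).det|⁻¹) ∈ Set.Ioo 0 ⊤ :=
    ⟨ENNReal.ofReal_pos.mpr (inv_pos.mpr (abs_pos.mpr hH.ne_zero)), ENNReal.ofReal_lt_top⟩
  have hpos : ∀ {I : ℝ≥0∞}, I ∈ Set.Ioo 0 ⊤ →
      ENNReal.ofReal (|(coordMatrix RE D e).det|⁻¹) * I / Z ∈ Set.Ioo 0 ⊤ := fun hI =>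
    ⟨ENNReal.div_pos (mul_ne_zero hJ.1.ne' hI.1.ne') hZ.2.ne,
      ENNReal.div_lt_top (ENNReal.mul_lt_top hJ.2 hI.2).ne hZ.1.ne'⟩
  have hm : margDensity RE D e π rE ∈ Set.Ioo 0 ⊤ := by
    rw [margDensity_eq hZ hπ]
    exact hpos hall
  have hc := condProb_eq (RO := RO) (rO := rO) hZ hπ hm.1.ne'
  refine ⟨hm, ⟨?_, ?_⟩, ?_⟩
  · rw [hc]
    exact ENNReal.div_pos (hpos hreg).1.ne' hm.2.ne
  · rw [hc]
    refine ENNReal.div_le_of_le_mul ?_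
    rw [one_mul, margDensity_eq hZ hπ]
    gcongr
    exact Measure.restrict_le_self
  · rw [hc, ENNReal.mul_div_cancel hm.1.ne' hm.2.ne]

end Conditional

/-- All quantities are positive and finite, so the cancellation of κ and J can be carried out in the
reals. -/
lemma ratio_eq_of_mul_eq {κ J I I' Z Z' fE fO cE cO : ℝ≥0∞}
    (hκ : κ ∈ Set.Ioo 0 ⊤) (hJ : J ∈ Set.Ioo 0 ⊤) (hI : I ∈ Set.Ioo 0 ⊤) (hI' : I' ∈ Set.Ioo 0 ⊤)
    (hZ : Z ∈ Set.Ioo 0 ⊤) (hZ' : Z' ∈ Set.Ioo 0 ⊤) (hfE : fE ∈ Set.Ioo 0 ⊤)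
    (hcE : cE ∈ Set.Ioo 0 ⊤) (hfO : fO ∈ Set.Ioc 0 1) (hcO : cO ∈ Set.Ioc 0 1)
    (hf : fE * fO = J * I / Z) (hc : cE * cO = J * I' / Z') :
    κ * I / (κ * I') / (Z / Z') = fE / cE * (fO / cO) := by
  have hpos : ∀ {x : ℝ≥0∞}, x ∈ Set.Ioo 0 ⊤ → 0 < x.toReal := fun hx =>
    ENNReal.toReal_pos hx.1.ne' hx.2.ne
  have hfO' : fO ∈ Set.Ioo 0 ⊤ := ⟨hfO.1, hfO.2.trans_lt ENNReal.one_lt_top⟩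
  have hcO' : cO ∈ Set.Ioo 0 ⊤ := ⟨hcO.1, hcO.2.trans_lt ENNReal.one_lt_top⟩
  have h1 : κ * I / (κ * I') / (Z / Z') ≠ ⊤ := by
    refine (ENNReal.div_lt_top (ENNReal.div_lt_top (ENNReal.mul_lt_top hκ.2 hI.2).ne
      (mul_ne_zero hκ.1.ne' hI'.1.ne')).ne (ENNReal.div_pos hZ.1.ne' hZ'.2.ne).ne').ne
  have h2 : fE / cE * (fO / cO) ≠ ⊤ :=
    (ENNReal.mul_lt_top (ENNReal.div_lt_top hfE.2.ne hcE.1.ne')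
      (ENNReal.div_lt_top hfO'.2.ne hcO.1.ne')).ne
  rw [← ENNReal.toReal_eq_toReal_iff' h1 h2]
  have hf' := congrArg ENNReal.toReal hf
  have hc' := congrArg ENNReal.toReal hc
  simp only [ENNReal.toReal_mul, ENNReal.toReal_div] at hf' hc' ⊢
  have := hpos hκ
  have := hpos hJ
  have := hpos hI
  have := hpos hI'
  have := hpos hZ
  have := hpos hZ'
  have := hpos hcE
  have := hpos hcO'
  rw [div_mul_div_comm, hf', hc']
  field_simp

end MVLM

end

/-! ### The Bayes factor and the matrix t forms -/

theorem lemma1 {N K P qE qO d : ℕ}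
    -- data and fractions
    (Y : Matrix (Fin N) (Fin P) ℝ) (X : Matrix (Fin N) (Fin K) ℝ) (b : Fin N → ℝ)
    (hb : ∀ i, 0 < b i)
    (hX : X.rank = K) (hS : (MVLM.sumSq Y X).PosDef)
    (hdf : 0 < (∑ i, b i) - (K : ℝ) - (P : ℝ) + 1)
    -- constraints
    (RE : Matrix (Fin qE) (Fin P × Fin K) ℝ) (rE : Fin qE → ℝ)
    (RO : Matrix (Fin qO) (Fin P × Fin K) ℝ) (rO : Fin qO → ℝ)
    (hM : (MVLM.constrSet RE rE RO rO).Nonempty)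
    (Th0 : Matrix (Fin K) (Fin P) ℝ)
    (h0E : RE *ᵥ Th0.vec = rE) (h0O : RO *ᵥ Th0.vec = rO)
    -- coordinates `ζ = (R_E θ, D θ)` completing `R_E θ`
    (D : Matrix (Fin d) (Fin P × Fin K) ℝ) (e : Fin qE ⊕ Fin d ≃ Fin P × Fin K)
    (hH : IsUnit (MVLM.coordMatrix RE D e).det) :
    let Yb := MVLM.fracRows b Y
    let Xb := MVLM.fracRows b X
    let post := MVLM.posterior Y X
    let prior := MVLM.defaultPrior Y X b Th0
    let fE := MVLM.margDensity RE D e post rE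
    let cE := MVLM.margDensity RE D e prior rE
    let fO := MVLM.condProb RE D e RO rO post rE
    let cO := MVLM.condProb RE D e RO rO prior rE
    -- the integrals that define the Bayes factor are positive and finite
    (MVLM.evidence (P * K - qE) (MVLM.constrSet RE rE RO rO) (MVLM.likelihood Y X)
        ∈ Set.Ioo 0 ⊤ ∧
      MVLM.evidence (P * K - qE) (MVLM.adjConstrSet RE RO (MVLM.lsEst Yb Xb))
        (MVLM.fracLikelihood b Y X) ∈ Set.Ioo 0 ⊤ ∧
      MVLM.evidence (P * K) Set.univ (MVLM.likelihood Y X) ∈ Set.Ioo 0 ⊤ ∧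
      MVLM.evidence (P * K) Set.univ (MVLM.fracLikelihood b Y X) ∈ Set.Ioo 0 ⊤) ∧
    -- so are the densities, and the conditional probabilities lie in `(0, 1]`
    (fE ∈ Set.Ioo 0 ⊤ ∧ cE ∈ Set.Ioo 0 ⊤ ∧ fO ∈ Set.Ioc 0 1 ∧ cO ∈ Set.Ioc 0 1) ∧
    -- factorization of the Bayes factor
    MVLM.bayesFactor Y X b RE rE RO rO = fE / cE * (fO / cO) ∧
    -- the posterior and the default prior of `Θ` are matrix `t`
    (∀ Th, post Th = ENNReal.ofReal (MVLM.matrixTDensity (MVLM.lsEst Y X) (Xᵀ * X)⁻¹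
      (MVLM.sumSq Y X) ((N : ℝ) - K - P + 1) Th)) ∧
    (∀ Th, prior Th = ENNReal.ofReal (MVLM.matrixTDensity Th0 (Xbᵀ * Xb)⁻¹
      (MVLM.sumSq Yb Xb) ((∑ i, b i) - (K : ℝ) - (P : ℝ) + 1) Th)) := by
  intro Yb Xb post prior fE cE fO cO
  have hXi := MVLM.injective_mulVec_of_rank_eq hX
  have hG := MVLM.posDef_transpose_mul_self hXi
  have hGb : (Xbᵀ * Xb).PosDef :=
    MVLM.posDef_transpose_mul_self (MVLM.injective_fracRows_mulVec hb hXi)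
  have hSb : (MVLM.sumSq Yb Xb).PosDef := MVLM.posDef_sumSq_fracRows hb hG hS
  -- The full likelihood is treated as the fractional one with all fractions equal to 1.
  have hb1 : ∀ _ : Fin N, (0 : ℝ) < 1 := fun _ => one_pos
  have hG1 : ((MVLM.fracRows (fun _ => 1) X)ᵀ * MVLM.fracRows (fun _ => 1) X).PosDef := by
    rwa [MVLM.fracRows_one]
  have hS1 : (MVLM.sumSq (MVLM.fracRows (fun _ => 1) Y)
      (MVLM.fracRows (fun _ => 1) X)).PosDef := by
    rwa [MVLM.fracRows_one, MVLM.fracRows_one]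
  have hsum1 : ∑ _i : Fin N, (1 : ℝ) = N := by simp
  -- The degrees of freedom of the posterior need no separate assumption: definiteness of S forces K
  -- + P ≤ N.
  have hn1 : 0 < (∑ _i : Fin N, (1 : ℝ)) - (K : ℝ) - (P : ℝ) + 1 := by
    have h : ((K + P : ℕ) : ℝ) ≤ N := by exact_mod_cast MVLM.add_le_of_posDef_sumSq hG hS
    push_cast at h
    rw [hsum1]
    linarith
  set C := MVLM.lsEst Yb Xb with hC
  have hZ1 := MVLM.evidence_univ_mem_Ioo hb1 hG1 hS1 hn1
  have hZb := MVLM.evidence_univ_mem_Ioo hb hGb hSb hdf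
  have hκ : ENNReal.ofReal (MVLM.freeMap RE D e).normDet ∈ Set.Ioo 0 ⊤ :=
    ⟨ENNReal.ofReal_pos.mpr (MVLM.normDet_freeMap_pos hH), ENNReal.ofReal_lt_top⟩
  have hJ : ENNReal.ofReal (|(MVLM.coordMatrix RE D e).det|⁻¹) ∈ Set.Ioo 0 ⊤ :=
    ⟨ENNReal.ofReal_pos.mpr (inv_pos.mpr (abs_pos.mpr hH.ne_zero)), ENNReal.ofReal_lt_top⟩
  have hopen := MVLM.isOpen_orderRegion (RE := RE) (rE := rE) (RO := RO) (rO := rO) (D := D)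
    (e := e)
  have hne := MVLM.orderRegion_nonempty hH hM
  have hE1 := MVLM.evidence_translate (b := fun _ => 1) (Y := Y) (X := X) (rE := rE) (RO := RO)
    (rO := rO) hH (M := MVLM.constrSet RE rE RO rO) 0 (by simp [MVLM.constrSet])
  -- The equations for Θ₀ enter here: translating the adjusted space back by C - Θ₀ gives the
  -- original constraints, so both evidences use the same region.
  have hEb := MVLM.evidence_translate (b := b) (Y := Y) (X := X) (rE := rE) (RO := RO)
    (rO := rO) hH (M := MVLM.adjConstrSet RE RO C) (C - Th0) (by
      intro θ
      have h : θ.ofLp - (C - Th0).vec = (θ.ofLp - C.vec) + Th0.vec := by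
        rw [Matrix.vec_sub]
        abel
      rw [h, mulVec_add, mulVec_add, h0E, h0O]
      simp [MVLM.adjConstrSet])
  have hI1 := MVLM.setLIntegral_thetaWeight_mem_Ioo hb1 hG1 hS1 hn1 hH (rE := rE) 0 hopen hne
  have hIb := MVLM.setLIntegral_thetaWeight_mem_Ioo hb hGb hSb hdf hH (rE := rE) (C - Th0)
    hopen hne
  -- The whole slice, needed for the marginal densities at r_E.
  have hA1 := MVLM.setLIntegral_thetaWeight_mem_Ioo hb1 hG1 hS1 hn1 hH (rE := rE) 0
    isOpen_univ Set.univ_nonempty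
  have hAb := MVLM.setLIntegral_thetaWeight_mem_Ioo hb hGb hSb hdf hH (rE := rE) (C - Th0)
    isOpen_univ Set.univ_nonempty
  rw [Measure.restrict_univ] at hA1 hAb
  have hpost : ∀ Th, post Th =
      MVLM.thetaWeight (MVLM.fracLikelihood (fun _ => 1) Y X) (Th + 0) /
        MVLM.evidence (P * K) Set.univ (MVLM.fracLikelihood (fun _ => 1) Y X) := by
    intro Th
    rw [add_zero, MVLM.thetaWeight, ← MVLM.thetaDensity_eq_div _ hZ1, MVLM.fracLikelihood_one]
    rfl
  have hprior : ∀ Th, prior Th =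
      MVLM.thetaWeight (MVLM.fracLikelihood b Y X) (Th + (C - Th0)) /
        MVLM.evidence (P * K) Set.univ (MVLM.fracLikelihood b Y X) := by
    intro Th
    rw [MVLM.thetaWeight, ← MVLM.thetaDensity_eq_div _ hZb, ← add_sub_assoc]
    rfl
  obtain ⟨hfE, hfO, hf⟩ := MVLM.margDensity_condProb (RO := RO) (rO := rO)
    (w := fun Th => MVLM.thetaWeight (MVLM.fracLikelihood (fun _ => 1) Y X) (Th + 0))
    hH hZ1 hpost hA1 hI1
  obtain ⟨hcE, hcO, hc⟩ := MVLM.margDensity_condProb (RO := RO) (rO := rO)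
    (w := fun Th => MVLM.thetaWeight (MVLM.fracLikelihood b Y X) (Th + (C - Th0)))
    hH hZb hprior hAb hIb
  have hmul : ∀ {I : ℝ≥0∞}, I ∈ Set.Ioo 0 ⊤ →
      ENNReal.ofReal (MVLM.freeMap RE D e).normDet * I ∈ Set.Ioo 0 ⊤ := fun hI =>
    ⟨ENNReal.mul_pos hκ.1.ne' hI.1.ne', ENNReal.mul_lt_top hκ.2 hI.2⟩
  have hE1' := hmul hI1
  have hEb' := hmul hIb
  rw [← hE1] at hE1'
  rw [← hEb] at hEb'
  have hT1 := MVLM.thetaDensity_fracLikelihood hb1 hG1 hS1 hn1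
  have hTb := MVLM.thetaDensity_fracLikelihood hb hGb hSb hdf
  have hB : MVLM.bayesFactor Y X b RE rE RO rO = fE / cE * (fO / cO) := by
    rw [MVLM.bayesFactor, MVLM.constrMargLik, MVLM.uncMargLik, ← MVLM.fracLikelihood_one, hE1, hEb]
    exact MVLM.ratio_eq_of_mul_eq hκ hJ hI1 hIb hZ1 hZb hfE hcE hfO hcO hf hc
  simp only [MVLM.fracRows_one, MVLM.fracLikelihood_one, hsum1] at hE1' hZ1 hT1
  refine ⟨⟨hE1', hEb', hZ1, hZb⟩, ⟨hfE, hcE, hfO, hcO⟩, hB, hT1, fun Th => ?_⟩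
  have h := hTb (Th + C - Th0)
  refine h.trans ?_
  congr 1
  -- The translation in the default prior replaces the location C by Θ₀ and leaves the scales
  -- unchanged.
  have e1 : Th + C - Th0 - C = Th - Th0 := by abel
  simp only [MVLM.matrixTDensity]
  rw [← hC, e1]
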